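/- Let $q$ be a power of an odd prime $p$, let $V$ be a four-dimensional symplectic vector space over $\mathbb{F}_q$ with form $\langle\cdot,\cdot\rangle_V$, and let $E=\mathbb{F}_{q^2}$ be the two-dimensional $\mathbb{F}_q$-space with the symmetric bilinear form $\langle x,y\rangle_E=\tfrac12(xy^q+x^qy)$. The eight-dimensional space $V\otimes E$ carries the symplectic form $\langle\cdot,\cdot\rangle=\langle\cdot,\cdot\rangle_V\otimes\langle\cdot,\cdot\rangle_E$, and $(g,t)\mapsto g\otimes t$ is a homomorphism $Sp(V)\times O(E)\to Sp(V\otimes E)$. Let $K$ be an algebraically closed field of characteristic $0$ (for example $\overline{\mathbb{Q}}_\ell$ with $\ell\ne p$), let $\psi:\mathbb{F}_q\to K^\times$ be a non-trivial additive character, and let $V=L\oplus L'$ with $L,L'$ Lagrangian. Let $W$ be the space of $K$-valued functions on $L'\otimes E$. For $x=a+b$ with $a\in L\otimes E$, $b\in L'\otimes E$ put $(\rho(x)f)(v)=\psi\bigl(\langle a,v\rangle-\tfrac12\langle a,b\rangle\bigr)f(v-b)$; this is the irreducible representation of the Heisenberg group of $V\otimes E$ with central character $\psi$. The Weil representation is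 the representation $\omega$ of $Sp(V\otimes E)$ on $W$ with $\omega(g)\rho(x)\omega(g)^{-1}=\rho(gx)$ for all $g\in Sp(V\otimes E)$, $x\in V\otimes E$. Through it $Sp(V)$ and $O(E)$ act on $W$, and these actions commute. For a character $\theta:SO(E)\to K^\times$ let $W_\theta=\{f\in W: \omega(1\otimes t)f=\theta(t)f\text{ for all }t\in SO(E)\}$, a representation of $Sp(V)$. Let $\Lambda=\omega(1\otimes\sigma)$, where $\sigma\in O(E)$ is $\sigma(x)=x^q$, and let $\nu$ be the character of order $2$ of the cyclic group $SO(E)$. For $\theta\in\{1,\nu\}$ let $W_\theta^{\pm}=\{f\in W_\theta:\Lambda f=\pm f\}$, again representations of $Sp(V)$. Then: 1. $(\omega(1\otimes t)f)(v)=f((1\otimes t^{-1})v)$ for all $t\in O(E)$, $f\in W$ and $v\in L'\otimes E$. 2. For every character $\theta\neq 1,\nu$ of $SO(E)$, the $Sp(V)$-representation $W_\theta$ is irreducible and $W_\theta\cong W_{\theta^{-1}}$. 3. The four $Sp(V)$-representations $W_1^{+},W_1^{-},W_\nu^{+},W_\nu^{-}$ are irreducible. 4. These representations are pairwise non-isomorphic,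 apart from $W_\theta\cong W_{\theta^{-1}}$: if $\theta,\theta'\ne1,\nu$ and $W_\theta\cong W_{\theta'}$, then $\theta'\in\{\theta,\theta^{-1}\}$; no $W_\theta$ with $\theta\neq1,\nu$ is isomorphic to any of $W_1^\pm,W_\nu^\pm$; and the four representations $W_1^\pm,W_\nu^\pm$ are pairwise non-isomorphic. 5. $\dim_K\operatorname{End}_{Sp(V)}(W)$ equals the number of $Sp(V)$-orbits on $V\otimes E$, and this number is $2q+2$. -/

import Mathlib

set_option linter.unusedSectionVars false

open scoped TensorProduct

namespace Weil

/-- The group of linear automorphisms of `M` preserving the bilinear form `B`.  It is the symplectic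
group if `B` is symplectic, and the orthogonal group if `B` is symmetric and nondegenerate. -/
def isometryGroup {F M : Type*} [Field F] [AddCommGroup M] [Module F M]
    (B : LinearMap.BilinForm F M) : Subgroup (M ≃ₗ[F] M) where
  carrier := {g | ∀ x y, B (g x) (g y) = B x y}
  one_mem' := fun _ _ => rfl
  mul_mem' := fun {g h} hg hh x y => (hg (h x) (h y)).trans (hh x y)
  inv_mem' := fun {g} hg x y => by
    have h1 := hg (g⁻¹ x) (g⁻¹ y)
    have h2 : ∀ z, g (g⁻¹ z) = z := fun z => g.apply_symm_apply z
    rw [h2, h2] at h1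
    exact h1.symm

/-- `B` is a symplectic form on `M`, and `A`, `A'` are complementary Lagrangian subspaces. -/
structure IsPolarization {F M : Type*} [Field F] [AddCommGroup M] [Module F M]
    (B : LinearMap.BilinForm F M) (A A' : Submodule F M) : Prop where
  isAlt : B.IsAlt
  nondegenerate : B.Nondegenerate
  lagrangian_left : B.orthogonal A = A
  lagrangian_right : B.orthogonal A' = A'
  isCompl : IsCompl A A'

/-- The action of the element `(x, 0)` of the Heisenberg group `M × F`, with multiplication
`(x, s) (y, t) = (x + y, s + t + B x y / 2)`, in its representation with central character `ψ` on
the space of functions on `A'`.  (The central element `(0, t)` acts by the scalar `ψ t`.) -/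
noncomputable def heis {F K M : Type*} [Field F] [Field K] [AddCommGroup M] [Module F M]
    (B : LinearMap.BilinForm F M) {A A' : Submodule F M} (hc : IsCompl A A') (ψ : AddChar F K)
    (x : M) : Module.End K (A' → K) where
  toFun f := fun v =>
    ψ (B (A.projectionOnto A' hc x) v
        - 2⁻¹ * B (A.projectionOnto A' hc x) (A'.projectionOnto A hc.symm x))
      * f (v - A'.projectionOnto A hc.symm x)
  map_add' f g := by ext v; simp [mul_add]
  map_smul' c f := by ext v; simp [mul_left_comm]

section Construction

variable {F K M : Type*} [Field F] [Field K] [AddCommGroup M] [Module F M]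
  {B : LinearMap.BilinForm F M} {A A' : Submodule F M}

lemma heis_apply (hc : IsCompl A A') (ψ : AddChar F K) (x : M) (f : A' → K) (v : A') :
    heis B hc ψ x f v = ψ (B (A.projectionOnto A' hc x) v
        - 2⁻¹ * B (A.projectionOnto A' hc x) (A'.projectionOnto A hc.symm x))
      * f (v - A'.projectionOnto A hc.symm x) := rfl

lemma heis_left (hc : IsCompl A A') (ψ : AddChar F K) (a : A) (f : A' → K) (v : A') :
    heis B hc ψ (a : M) f v = ψ (B a v) * f v := by
  simp [heis_apply]

lemma heis_right (hc : IsCompl A A') (ψ : AddChar F K) (w : A') (f : A' → K) (v : A') :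
    heis B hc ψ (w : M) f v = f (v - w) := by
  simp [heis_apply]

lemma heis_zero (hc : IsCompl A A') (ψ : AddChar F K) : heis B hc ψ 0 = 1 := by
  ext1 f
  ext v
  simp [heis_apply]

lemma form_isotropic_left (hP : IsPolarization B A A') (a b : A) : B a b = 0 := by
  have h : (b : M) ∈ B.orthogonal A := by rw [hP.lagrangian_left]; exact b.2
  exact h a a.2

lemma form_isotropic_right (hP : IsPolarization B A A') (a b : A') : B a b = 0 := by
  have h : (b : M) ∈ B.orthogonal A' := by rw [hP.lagrangian_right]; exact b.2
  exact h a a.2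

lemma decomp (hc : IsCompl A A') (x : M) :
    (A.projectionOnto A' hc x : M) + (A'.projectionOnto A hc.symm x : M) = x := by
  simpa using Submodule.projection_add_projection_eq_self hc x

lemma heis_mul (hP : IsPolarization B A A') (ψ : AddChar F K) (h2 : (2 : F) ≠ 0) (x y : M) :
    heis B hP.isCompl ψ x * heis B hP.isCompl ψ y
      = ψ (2⁻¹ * B x y) • heis B hP.isCompl ψ (x + y) := by
  ext1 f
  ext v
  have hxy : B x y = B (A.projectionOnto A' hP.isCompl x) (A'.projectionOnto A hP.isCompl.symm y)
      - B (A.projectionOnto A' hP.isCompl y) (A'.projectionOnto A hP.isCompl.symm x) := by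
    conv_lhs => rw [← decomp hP.isCompl x, ← decomp hP.isCompl y]
    simp only [map_add, LinearMap.add_apply]
    rw [form_isotropic_left hP, form_isotropic_right hP,
      ← hP.isAlt.neg_eq (A.projectionOnto A' hP.isCompl y : M)]
    ring
  simp only [Module.End.mul_apply, heis_apply, LinearMap.smul_apply, Pi.smul_apply, smul_eq_mul]
  rw [← mul_assoc, ← mul_assoc, ← AddChar.map_add_eq_mul, ← AddChar.map_add_eq_mul]
  congr 2
  · rw [hxy]
    simp only [map_add, Submodule.coe_add, Submodule.coe_sub, LinearMap.add_apply, map_sub]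
    field_simp
    ring
  · rw [map_add]; abel_nf

lemma sum_char [Fintype M] (ψ : AddChar F K) (hψ : ψ ≠ 1) (φ : M →ₗ[F] F) [Decidable (φ = 0)] :
    ∑ m, ψ (φ m) = if φ = 0 then (Fintype.card M : K) else 0 := by
  classical
  have h := AddChar.sum_eq_ite (ψ.compAddMonoidHom φ.toAddMonoidHom)
  have h1 : ψ.compAddMonoidHom φ.toAddMonoidHom = 0 ↔ φ = 0 := by
    constructor
    · intro h0
      by_contra hφ
      apply hψ
      ext t
      obtain ⟨m, hm⟩ : ∃ m, φ m ≠ 0 := by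
        by_contra hcon
        push Not at hcon
        exact hφ (LinearMap.ext hcon)
      have := DFunLike.congr_fun h0 ((t / φ m) • m)
      simpa [hm] using this
    · rintro rfl
      ext t
      simp
  simp only [h1] at h
  simpa using h

lemma eq_zero_of_pairing (hP : IsPolarization B A A') (v : A') (h : ∀ a : A, B a v = 0) :
    v = 0 := by
  have h1 : (v : M) ∈ A := by
    rw [← hP.lagrangian_left]
    exact fun a ha => h ⟨a, ha⟩
  have h3 := hP.isCompl.disjoint.le_bot ⟨h1, v.2⟩
  exact Subtype.ext (by simpa using h3)

variable [Finite M]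

lemma sum_heis_left [Fintype A] [DecidableEq A'] (hP : IsPolarization B A A') (ψ : AddChar F K)
    (hψ : ψ ≠ 1) (f : A' → K) :
    ∑ a : A, heis B hP.isCompl ψ (a : M) f = ((Fintype.card A : K) * f 0) • Pi.single 0 1 := by
  classical
  ext v
  simp only [Finset.sum_apply, heis_left, ← Finset.sum_mul]
  have h := sum_char ψ hψ ((B.flip (v : M)).comp A.subtype)
  simp only [LinearMap.comp_apply, Submodule.subtype_apply, LinearMap.BilinForm.flip_apply] at h
  rw [h]
  by_cases hv : v = 0
  · subst hv
    simp
  · rw [if_neg]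
    · simp [hv]
    · intro h0
      exact hv (eq_zero_of_pairing hP v fun a => by simpa using LinearMap.congr_fun h0 a)

lemma card_ne_zero [CharZero K] (S : Submodule F M) [Fintype S] : (Fintype.card S : K) ≠ 0 :=
  Nat.cast_ne_zero.mpr Fintype.card_ne_zero

/-- The functions on `A'` form an irreducible representation of the Heisenberg group. -/
lemma eq_top_of_invariant [CharZero K] (hP : IsPolarization B A A') (ψ : AddChar F K) (hψ : ψ ≠ 1)
    (S : Submodule K (A' → K)) (hS : ∀ x, ∀ f ∈ S, heis B hP.isCompl ψ x f ∈ S)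
    (f : A' → K) (hf : f ∈ S) (hf0 : f ≠ 0) : S = ⊤ := by
  classical
  cases nonempty_fintype A
  cases nonempty_fintype A'
  obtain ⟨v, hv⟩ : ∃ v, f v ≠ 0 := Function.ne_iff.mp hf0
  have h0 : (Pi.single 0 1 : A' → K) ∈ S := by
    have h1 : ∑ a : A, heis B hP.isCompl ψ (a : M) (heis B hP.isCompl ψ ((-v : A') : M) f) ∈ S :=
      Submodule.sum_mem _ fun a _ => hS _ _ (hS _ _ hf)
    rw [sum_heis_left hP ψ hψ, heis_right] at h1
    refine (Submodule.smul_mem_iff _ ?_).mp h1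
    exact mul_ne_zero (card_ne_zero A) (by simpa using hv)
  have h1 : ∀ w : A', (Pi.single w 1 : A' → K) ∈ S := by
    intro w
    have h2 := hS (w : M) _ h0
    convert h2 using 1
    ext u
    simp [heis_right, Pi.single_apply, sub_eq_zero]
  rw [eq_top_iff]
  intro g _
  rw [pi_eq_sum_univ' g]
  refine Submodule.sum_mem _ fun w _ => Submodule.smul_mem _ _ ?_
  convert h1 w using 1

/-- Schur's lemma for the representation of the Heisenberg group. -/
lemma scalar_of_commute [CharZero K] (hP : IsPolarization B A A') (ψ : AddChar F K) (hψ : ψ ≠ 1)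
    (T : Module.End K (A' → K))
    (hT : ∀ x, T * heis B hP.isCompl ψ x = heis B hP.isCompl ψ x * T) : ∃ c : K, T = c • 1 := by
  classical
  cases nonempty_fintype A
  have hT' : ∀ x f, T (heis B hP.isCompl ψ x f) = heis B hP.isCompl ψ x (T f) :=
    fun x f => LinearMap.congr_fun (hT x) f
  set δ : A' → K := Pi.single 0 1 with hδ
  have hA := card_ne_zero (K := K) A
  have h1 : T δ = T δ 0 • δ := by
    have h2 := sum_heis_left hP ψ hψ δ
    have h3 := congrArg T h2
    rw [map_sum] at h3
    simp only [hT'] at h3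
    rw [sum_heis_left hP ψ hψ] at h3
    simp only [map_smul] at h3
    have h4 : δ 0 = 1 := by simp [hδ]
    rw [h4, mul_one, mul_smul] at h3
    exact (smul_right_injective _ hA h3).symm
  refine ⟨T δ 0, ?_⟩
  have h5 : LinearMap.ker (T - T δ 0 • (1 : Module.End K (A' → K))) = ⊤ := by
    refine eq_top_of_invariant hP ψ hψ _ ?_ δ ?_ ?_
    · intro x f hf
      simp only [LinearMap.mem_ker, LinearMap.sub_apply, LinearMap.smul_apply,
        Module.End.one_apply, sub_eq_zero] at hf ⊢
      rw [hT', hf, map_smul]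
    · simpa [sub_eq_zero] using h1
    · intro h
      have := congrFun h 0
      simp [hδ] at this
  exact sub_eq_zero.mp (LinearMap.ker_eq_top.mp h5)

/-- `T` intertwines the representation of the Heisenberg group with its twist by `g`. -/
def Intertwines (hP : IsPolarization B A A') (ψ : AddChar F K) (g : M ≃ₗ[F] M)
    (T : Module.End K (A' → K)) : Prop :=
  ∀ x, T * heis B hP.isCompl ψ x = heis B hP.isCompl ψ (g x) * T

lemma Intertwines.mul {hP : IsPolarization B A A'} {ψ : AddChar F K} {g h : M ≃ₗ[F] M}
    {S T : Module.End K (A' → K)} (hS : Intertwines hP ψ g S) (hT : Intertwines hP ψ h T) :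
    Intertwines hP ψ (g * h) (S * T) := fun x => by
  rw [mul_assoc, hT x, ← mul_assoc, hS, mul_assoc]; rfl

lemma Intertwines.isUnit [CharZero K] {hP : IsPolarization B A A'} {ψ : AddChar F K} (hψ : ψ ≠ 1)
    {g : M ≃ₗ[F] M} {T : Module.End K (A' → K)} (hT : Intertwines hP ψ g T) (h0 : T ≠ 0) :
    IsUnit T := by
  rw [LinearMap.isUnit_iff_ker_eq_bot]
  by_contra hker
  obtain ⟨f, hf, hf0⟩ := Submodule.exists_mem_ne_zero_of_ne_bot hker
  refine h0 (LinearMap.ker_eq_top.mp (eq_top_of_invariant hP ψ hψ _ ?_ f hf hf0))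
  intro x u hu
  have h1 := LinearMap.congr_fun (hT x) u
  simp only [Module.End.mul_apply, LinearMap.mem_ker] at h1 hu ⊢
  rw [h1, hu, map_zero]

/-- Uniqueness, up to scalars, of intertwining operators. -/
lemma Intertwines.unique [CharZero K] {hP : IsPolarization B A A'} {ψ : AddChar F K} (hψ : ψ ≠ 1)
    {g : M ≃ₗ[F] M} {S T : Module.End K (A' → K)} (hS : Intertwines hP ψ g S)
    (hT : Intertwines hP ψ g T) (hT0 : T ≠ 0) : ∃ c : K, S = c • T := by
  obtain ⟨u, rfl⟩ := hT.isUnit hψ hT0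
  have key : ∀ x, heis B hP.isCompl ψ x * (↑u⁻¹ : Module.End K (A' → K))
      = ↑u⁻¹ * heis B hP.isCompl ψ (g x) := fun x => by
    rw [Units.eq_inv_mul_iff_mul_eq, ← mul_assoc, hT x, mul_assoc, Units.mul_inv, mul_one]
  obtain ⟨c, hc⟩ := scalar_of_commute hP ψ hψ (S * ↑u⁻¹) (fun x => by
    have h1 := key (g.symm x)
    rw [g.apply_symm_apply] at h1
    rw [mul_assoc, ← h1, ← mul_assoc, hS, g.apply_symm_apply, mul_assoc])
  refine ⟨c, ?_⟩
  rw [Units.mul_inv_eq_iff_eq_mul] at hc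
  simpa using hc

/-- Existence of intertwining operators. -/
lemma exists_intertwines [CharZero K] (hP : IsPolarization B A A') (ψ : AddChar F K) (hψ : ψ ≠ 1)
    (h2 : (2 : F) ≠ 0) (g : isometryGroup B) :
    ∃ T : Module.End K (A' → K), Intertwines hP ψ g T ∧ T ≠ 0 := by
  classical
  cases nonempty_fintype M
  set ρ := heis B hP.isCompl ψ with hρ
  have hmul : ∀ x y, ρ x * ρ y = ψ (2⁻¹ * B x y) • ρ (x + y) := heis_mul hP ψ h2
  let avg : Module.End K (A' → K) → Module.End K (A' → K) :=
    fun S => ∑ x : M, ρ (g.1 x) * S * ρ (-x)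
  have hint : ∀ S, Intertwines hP ψ g (avg S) := by
    intro S y
    change avg S * ρ y = ρ (g.1 y) * avg S
    simp only [avg, Finset.sum_mul, Finset.mul_sum]
    refine (Fintype.sum_equiv (Equiv.addLeft y) _ _ fun z => ?_).symm
    simp only [Equiv.coe_addLeft]
    rw [mul_assoc _ (ρ _) (ρ y), hmul, ← mul_assoc, ← mul_assoc, hmul, map_add]
    have e1 : -(y + z) + y = -z := by abel
    have e2 : B (g.1 y) (g.1 z) = B y z := g.2 y z
    have e3 : B (-(y + z)) y = B y z := by
      simp only [map_neg, map_add, LinearMap.neg_apply, LinearMap.add_apply]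
      rw [hP.isAlt.self_eq_zero, ← hP.isAlt.neg_eq y z]
      ring
    rw [e1, e2, e3]
    simp
  by_contra hcon
  push Not at hcon
  have hz : ∀ S, avg S = 0 := fun S => hcon _ (hint S)
  set δ : A' → K := Pi.single 0 1 with hδ
  let c : M → K := fun x => ρ (-x) δ 0
  have hc0 : c 0 = 1 := by simp [c, hρ, heis_zero, hδ]
  have hsum : ∑ x : M, c x • ρ (g.1 x) = 0 := by
    refine LinearMap.ext fun u => ?_
    have h1 := LinearMap.congr_fun
      (hz ((LinearMap.proj (0 : A') : (A' → K) →ₗ[K] K).smulRight u)) δ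
    simp only [avg, LinearMap.sum_apply, Module.End.mul_apply, LinearMap.smulRight_apply,
      LinearMap.proj_apply, map_smul, LinearMap.zero_apply] at h1
    simpa [LinearMap.sum_apply] using h1
  have hconj : ∀ y x, ρ y * ρ x * ρ (-y) = ψ (B y x) • ρ x := by
    intro y x
    have e1 : y + x + -y = x := by abel
    have e2 : 2⁻¹ * B y x + 2⁻¹ * B (y + x) (-y) = B y x := by
      simp only [map_neg, map_add, LinearMap.add_apply]
      rw [hP.isAlt.self_eq_zero, ← hP.isAlt.neg_eq y x]
      field_simp
      ring
    rw [hmul, smul_mul_assoc, hmul, smul_smul, ← AddChar.map_add_eq_mul, e1, e2]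
  have h3 : ∑ y : M, ρ y * (∑ x : M, c x • ρ (g.1 x)) * ρ (-y) = (Fintype.card M : K) • ρ 0 := by
    simp only [Finset.mul_sum, Finset.sum_mul, mul_smul_comm, smul_mul_assoc, hconj]
    rw [Finset.sum_comm]
    simp only [← Finset.smul_sum, ← Finset.sum_smul]
    have h4 : ∀ x : M, ∑ y : M, ψ (B y (g.1 x)) = if x = 0 then (Fintype.card M : K) else 0 := by
      intro x
      have h5 := sum_char ψ hψ (B.flip (g.1 x))
      simp only [LinearMap.BilinForm.flip_apply] at h5
      rw [h5]
      congr 1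
      refine propext ⟨fun h6 => ?_, fun h6 => by simp [h6]⟩
      have h7 := hP.nondegenerate.2 (g.1 x) (fun y => by simpa using LinearMap.congr_fun h6 y)
      simpa using h7
    simp only [h4]
    rw [Finset.sum_eq_single 0]
    · simp [hc0]
    · intro x _ hx
      simp [hx]
    · simp
  rw [hsum] at h3
  simp only [mul_zero, zero_mul, Finset.sum_const_zero, hρ, heis_zero] at h3
  have h8 := congrFun (LinearMap.congr_fun h3 δ) 0
  have h9 : (Fintype.card M : K) ≠ 0 := Nat.cast_ne_zero.mpr Fintype.card_ne_zero
  simp [hδ] at h8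
  exact h9 h8.symm

/-- The subspace of functions `f` with `f (-v) = ε f v`. -/
def paritySubmodule (K : Type*) {F M : Type*} [Field F] [Field K] [AddCommGroup M] [Module F M]
    (A' : Submodule F M) (ε : ℤˣ) : Submodule K (A' → K) where
  carrier := {f | ∀ v, f (-v) = (ε : ℤ) • f v}
  add_mem' hf hg v := by simp [hf v, hg v]
  zero_mem' v := by simp
  smul_mem' c f hf v := by simp [hf v, mul_left_comm]

/-- The operator `(P f) v = f (-v)`. -/
def parity (K : Type*) {F M : Type*} [Field F] [Field K] [AddCommGroup M] [Module F M]
    (A' : Submodule F M) : Module.End K (A' → K) where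
  toFun f v := f (-v)
  map_add' _ _ := rfl
  map_smul' _ _ := rfl

lemma parity_mul_parity : parity K A' * parity K A' = 1 := by
  refine LinearMap.ext fun f => ?_
  ext v
  simp [parity]

lemma parity_intertwines (hP : IsPolarization B A A') (ψ : AddChar F K) (x : M) :
    parity K A' * heis B hP.isCompl ψ x = heis B hP.isCompl ψ (-x) * parity K A' := by
  refine LinearMap.ext fun f => ?_
  ext v
  simp only [Module.End.mul_apply, parity, LinearMap.coe_mk, AddHom.coe_mk, heis_apply]
  congr 2
  · simp
  · simp only [map_neg]; abel

lemma trace_parity (h2 : (2 : F) ≠ 0) : LinearMap.trace K (A' → K) (parity K A') = 1 := by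
  classical
  cases nonempty_fintype A'
  rw [LinearMap.trace_eq_matrix_trace K (Pi.basisFun K A'), Matrix.trace]
  simp only [Matrix.diag_apply, LinearMap.toMatrix_apply, Pi.basisFun_apply, Pi.basisFun_repr]
  have h : ∀ v : A', parity K A' (Pi.single v 1) v = if v = 0 then 1 else 0 := by
    intro v
    have h1 : (-v = v) ↔ v = 0 := by
      constructor
      · intro h
        have h3 : (2 : F) • v = 0 := by
          rw [two_smul]
          nth_rewrite 1 [← h]
          simp
        exact (smul_eq_zero.mp h3).resolve_left h2
      · rintro rfl
        simp
    simp [parity, Pi.single_apply, h1]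
  simp [h]

lemma finrank_parity [CharZero K] (h2 : (2 : F) ≠ 0) :
    Module.finrank K (paritySubmodule K A' 1)
      = Module.finrank K (paritySubmodule K A' (-1)) + 1 := by
  set P := parity K A' with hPdef
  have hPP : ∀ f, P (P f) = f := fun f => LinearMap.congr_fun parity_mul_parity f
  have mem_even : ∀ f, f ∈ paritySubmodule K A' 1 ↔ P f = f := fun f => by
    simp [paritySubmodule, hPdef, parity, funext_iff]
  have mem_odd : ∀ f, f ∈ paritySubmodule K A' (-1) ↔ P f = -f := fun f => by
    simp [paritySubmodule, hPdef, parity, funext_iff]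
  have h20 : (2 : K) ≠ 0 := two_ne_zero
  have hcompl : IsCompl (paritySubmodule K A' 1) (paritySubmodule K A' (-1)) := by
    refine ⟨Submodule.disjoint_def.mpr fun f h1 h3 => ?_, codisjoint_iff.mpr ?_⟩
    · rw [mem_even] at h1
      rw [mem_odd, h1] at h3
      have h4 : (2 : K) • f = 0 := by
        rw [two_smul]
        nth_rewrite 1 [h3]
        simp
      exact (smul_eq_zero.mp h4).resolve_left h20
    · rw [eq_top_iff]
      intro f _
      rw [Submodule.mem_sup]
      refine ⟨(2⁻¹ : K) • (f + P f), ?_, (2⁻¹ : K) • (f - P f), ?_, ?_⟩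
      · rw [mem_even, map_smul, map_add, hPP, add_comm]
      · rw [mem_odd, map_smul, map_sub, hPP, ← smul_neg, neg_sub]
      · rw [← smul_add, add_add_sub_cancel, ← two_smul K f, smul_smul, inv_mul_cancel₀ h20,
          one_smul]
  have hproj : LinearMap.IsProj (paritySubmodule K A' 1) ((2⁻¹ : K) • (1 + P)) := by
    refine ⟨fun f => ?_, fun f hf => ?_⟩
    · rw [mem_even]
      simp only [LinearMap.smul_apply, LinearMap.add_apply, Module.End.one_apply, map_smul,
        map_add, hPP]
      rw [add_comm]
    · rw [mem_even] at hf
      simp only [LinearMap.smul_apply, LinearMap.add_apply, Module.End.one_apply, hf]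
      rw [← two_smul K f, smul_smul, inv_mul_cancel₀ h20, one_smul]
  have htr := hproj.trace
  rw [map_smul, map_add, trace_parity h2, LinearMap.trace_one,
    ← Submodule.finrank_add_eq_of_isCompl hcompl, smul_eq_mul, inv_mul_eq_iff_eq_mul₀ h20] at htr
  push_cast at htr
  have h5 : (Module.finrank K (paritySubmodule K A' 1) : K)
      = Module.finrank K (paritySubmodule K A' (-1)) + 1 := by linear_combination -htr
  exact_mod_cast h5

lemma Intertwines.mapsTo [CharZero K] {hP : IsPolarization B A A'} {ψ : AddChar F K} (hψ : ψ ≠ 1)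
    (h2 : (2 : F) ≠ 0) {g : M ≃ₗ[F] M} {T : Module.End K (A' → K)} (hT : Intertwines hP ψ g T)
    (h0 : T ≠ 0) (ε : ℤˣ) : ∀ f ∈ paritySubmodule K A' ε, T f ∈ paritySubmodule K A' ε := by
  set P := parity K A' with hPdef
  obtain ⟨u, rfl⟩ := hT.isUnit hψ h0
  have hPi := parity_intertwines hP ψ
  have h1 : Intertwines hP ψ g (P * ↑u * P) := fun x => by
    rw [mul_assoc, hPi, ← mul_assoc, mul_assoc P, hT, ← mul_assoc, hPi, map_neg, neg_neg,
      mul_assoc, mul_assoc, mul_assoc]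
  obtain ⟨c, hc⟩ := h1.unique hψ hT h0
  have h3 : P * (u : Module.End K (A' → K)) = c • (u * P) := by
    have := congrArg (· * P) hc
    simpa [mul_assoc, parity_mul_parity, hPdef] using this
  have hc1 : c = 1 := by
    have h4 : (u⁻¹ : (Module.End K (A' → K))ˣ) * P * (u : Module.End K (A' → K)) = c • P := by
      rw [mul_assoc, h3, mul_smul_comm, Units.inv_mul_cancel_left]
    have h5 := congrArg (LinearMap.trace K (A' → K)) h4
    rw [LinearMap.trace_mul_comm, Units.mul_inv_cancel_left, map_smul, trace_parity h2] at h5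
    simpa using h5.symm
  rw [hc1, one_smul] at h3
  intro f hf v
  have h6 := congrFun (LinearMap.congr_fun h3 f) v
  have h7 : P f = (ε : ℤ) • f := funext hf
  rw [Module.End.mul_apply, Module.End.mul_apply, h7, map_zsmul] at h6
  exact h6

/-- The determinant of the operator induced by `T` on the functions of parity `ε` (for `T`
preserving these functions). -/
noncomputable def parityDet (T : Module.End K (A' → K)) (ε : ℤˣ) : K :=
  open Classical in
  if h : ∀ f ∈ paritySubmodule K A' ε, T f ∈ paritySubmodule K A' ε then
    LinearMap.det (T.restrict h) else 0

/-- Rescaling of an intertwining operator; the result depends on `T` up to scalars only, since the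
space of even functions has one dimension more than that of odd functions. -/
noncomputable def normalize (T : Module.End K (A' → K)) : Module.End K (A' → K) :=
  (parityDet T (-1) / parityDet T 1) • T

lemma parityDet_mul {S T : Module.End K (A' → K)} {ε : ℤˣ}
    (hS : ∀ f ∈ paritySubmodule K A' ε, S f ∈ paritySubmodule K A' ε)
    (hT : ∀ f ∈ paritySubmodule K A' ε, T f ∈ paritySubmodule K A' ε) :
    parityDet (S * T) ε = parityDet S ε * parityDet T ε := by
  have hST : ∀ f ∈ paritySubmodule K A' ε, (S * T) f ∈ paritySubmodule K A' ε :=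
    fun f hf => hS _ (hT f hf)
  rw [parityDet, parityDet, parityDet, dif_pos hS, dif_pos hT, dif_pos hST, ← map_mul]
  rfl

lemma parityDet_smul {c : K} {T : Module.End K (A' → K)} {ε : ℤˣ}
    (hT : ∀ f ∈ paritySubmodule K A' ε, T f ∈ paritySubmodule K A' ε) :
    parityDet (c • T) ε = c ^ Module.finrank K (paritySubmodule K A' ε) * parityDet T ε := by
  have hcT : ∀ f ∈ paritySubmodule K A' ε, (c • T) f ∈ paritySubmodule K A' ε :=
    fun f hf => Submodule.smul_mem _ c (hT f hf)
  rw [parityDet, parityDet, dif_pos hT, dif_pos hcT, ← LinearMap.det_smul]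
  rfl

lemma parityDet_one (ε : ℤˣ) : parityDet (1 : Module.End K (A' → K)) ε = 1 := by
  have h : ∀ f ∈ paritySubmodule K A' ε, (1 : Module.End K (A' → K)) f ∈ paritySubmodule K A' ε :=
    fun f hf => hf
  rw [parityDet, dif_pos h]
  exact LinearMap.det_id

lemma normalize_smul [CharZero K] (h2 : (2 : F) ≠ 0) {c : K} (hc : c ≠ 0)
    {T : Module.End K (A' → K)}
    (hT : ∀ ε, ∀ f ∈ paritySubmodule K A' ε, T f ∈ paritySubmodule K A' ε) :
    normalize (c • T) = normalize T := by
  rw [normalize, normalize, parityDet_smul (hT _), parityDet_smul (hT _), finrank_parity h2,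
    smul_smul]
  congr 1
  by_cases h : parityDet T 1 = 0
  · simp [h]
  · field_simp
    ring

lemma normalize_mul {S T : Module.End K (A' → K)}
    (hS : ∀ ε, ∀ f ∈ paritySubmodule K A' ε, S f ∈ paritySubmodule K A' ε)
    (hT : ∀ ε, ∀ f ∈ paritySubmodule K A' ε, T f ∈ paritySubmodule K A' ε) :
    normalize (S * T) = normalize S * normalize T := by
  rw [normalize, normalize, normalize, parityDet_mul (hS _) (hT _), parityDet_mul (hS _) (hT _),
    smul_mul_smul_comm, mul_div_mul_comm]

/-- The **Weil representation** of the symplectic group of `(M, B)` on the functions on the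
Lagrangian subspace `A'`: the operator of `g` intertwines the representation of the Heisenberg group
with central character `ψ` and its twist by `g`, and is scaled so that the operators
multiply as the group elements do. -/
noncomputable def weilRepresentation [CharZero K] (hP : IsPolarization B A A')
    (h2 : (2 : F) ≠ 0) (ψ : AddChar F K) (hψ : ψ ≠ 1) :
    Representation K (isometryGroup B) (A' → K) where
  toFun g := normalize (exists_intertwines hP ψ hψ h2 g).choose
  map_one' := by
    obtain ⟨h1, h0⟩ := (exists_intertwines hP ψ hψ h2 1).choose_spec
    have hone : Intertwines hP ψ ((1 : isometryGroup B) : M ≃ₗ[F] M)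
        (1 : Module.End K (A' → K)) := fun x => by simp
    obtain ⟨c, hc⟩ := h1.unique hψ hone one_ne_zero
    have hc0 : c ≠ 0 := by
      rintro rfl
      exact h0 (by rw [hc, zero_smul])
    rw [hc, normalize_smul h2 hc0 fun ε f hf => hf, normalize, parityDet_one, parityDet_one]
    simp
  map_mul' g h := by
    obtain ⟨hg, hg0⟩ := (exists_intertwines hP ψ hψ h2 g).choose_spec
    obtain ⟨hh, hh0⟩ := (exists_intertwines hP ψ hψ h2 h).choose_spec
    obtain ⟨hgh, hgh0⟩ := (exists_intertwines hP ψ hψ h2 (g * h)).choose_spec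
    have hmul := hg.mul hh
    have hmul0 := ((hg.isUnit hψ hg0).mul (hh.isUnit hψ hh0)).ne_zero
    obtain ⟨c, hc⟩ := hgh.unique hψ hmul hmul0
    have hc0 : c ≠ 0 := by
      rintro rfl
      exact hgh0 (by rw [hc, zero_smul])
    rw [hc, normalize_smul h2 hc0 (hmul.mapsTo hψ h2 hmul0),
      normalize_mul (hg.mapsTo hψ h2 hg0) (hh.mapsTo hψ h2 hh0)]

/-- The defining property of the Weil representation. -/
theorem weilRepresentation_intertwines [CharZero K] (hP : IsPolarization B A A')
    (h2 : (2 : F) ≠ 0) (ψ : AddChar F K) (hψ : ψ ≠ 1) (g : isometryGroup B) (x : M) :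
    weilRepresentation hP h2 ψ hψ g * heis B hP.isCompl ψ x
      = heis B hP.isCompl ψ (g.1 x) * weilRepresentation hP h2 ψ hψ g := by
  have h := (exists_intertwines hP ψ hψ h2 g).choose_spec.1 x
  change normalize _ * _ = _ * normalize _
  rw [normalize, smul_mul_assoc, h, mul_smul_comm]

end Construction

section Tensor

/-- The symmetric bilinear form `(x y ^ q + x ^ q y) / 2` on `E`, with values in `F`, where `q` is
the number of elements of `F`; it is obtained here as half the trace of `x y ^ q`, see
`algebraMap_normForm` for the formula if `E` is quadratic over `F`. -/
noncomputable def normForm (F E : Type*) [Field F] [Fintype F] [Field E] [Algebra F E]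
    [FiniteDimensional F E] : LinearMap.BilinForm F E :=
  (2⁻¹ : F) • (Algebra.traceForm F E).compRight
    (FiniteField.frobeniusAlgEquivOfAlgebraic F E).toLinearMap

variable {F E V K : Type*} [Field F] [Fintype F] [Field E] [Algebra F E] [FiniteDimensional F E]
  [AddCommGroup V] [Module F V] [FiniteDimensional F V] [Field K] [CharZero K]

lemma normForm_apply (x y : E) :
    normForm F E x y = 2⁻¹ * Algebra.trace F E (x * y ^ Fintype.card F) := by
  simp [normForm, Algebra.traceForm_apply]

lemma trace_quadratic (hE : Module.finrank F E = 2) (x : E) :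
    algebraMap F E (Algebra.trace F E x) = x + x ^ Fintype.card F := by
  have : Finite E := Module.finite_of_finite F
  rw [FiniteField.algebraMap_trace_eq_sum_pow, hE]
  simp [Finset.sum_range_succ, Nat.card_eq_fintype_card]

lemma pow_card_pow_card (hE : Module.finrank F E = 2) (x : E) :
    (x ^ Fintype.card F) ^ Fintype.card F = x := by
  have : Finite E := Module.finite_of_finite F
  cases nonempty_fintype E
  have h := FiniteField.pow_card x
  rwa [Module.card_eq_pow_finrank (K := F) (V := E), hE, sq, pow_mul] at h

lemma algebraMap_normForm (hE : Module.finrank F E = 2) (x y : E) :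
    algebraMap F E (normForm F E x y)
      = 2⁻¹ * (x * y ^ Fintype.card F + x ^ Fintype.card F * y) := by
  rw [normForm_apply, map_mul, trace_quadratic hE, mul_pow, pow_card_pow_card hE, map_inv₀,
    map_ofNat]

lemma normForm_symm (hE : Module.finrank F E = 2) (x y : E) :
    normForm F E x y = normForm F E y x := by
  apply FaithfulSMul.algebraMap_injective F E
  rw [algebraMap_normForm hE, algebraMap_normForm hE]
  ring

lemma normForm_nondegenerate (hE : Module.finrank F E = 2) (h2 : (2 : F) ≠ 0) :
    (normForm F E).Nondegenerate := by
  have hl : ∀ x : E, (∀ y, normForm F E x y = 0) → x = 0 := by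
    intro x hx
    refine (traceForm_nondegenerate F E).1 x fun z => ?_
    obtain ⟨y, rfl⟩ := (FiniteField.frobeniusAlgEquivOfAlgebraic F E).surjective z
    simpa [normForm, h2] using hx y
  exact ⟨hl, fun x hx => hl x fun y => (normForm_symm hE x y).trans (hx y)⟩

lemma tmul_isAlt {B : LinearMap.BilinForm F V} (hB : B.IsAlt) (hE : Module.finrank F E = 2)
    (h2 : (2 : F) ≠ 0) : LinearMap.BilinForm.IsAlt (B.tmul (normForm F E)) := by
  have hs : ∀ x y, B.tmul (normForm F E) x y = -B.tmul (normForm F E) y x := by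
    intro x y
    induction x with
    | zero => simp
    | add a b ha hb => simp only [map_add, LinearMap.add_apply, ha, hb, neg_add]
    | tmul a e =>
      induction y with
      | zero => simp
      | add a b ha hb => simp only [map_add, LinearMap.add_apply, ha, hb, neg_add]
      | tmul b e' =>
        simp only [LinearMap.BilinForm.tensorDistrib_tmul]
        rw [← hB.neg_eq b a, normForm_symm hE e e']
        simp
  intro x
  have h := hs x x
  have h3 : 2 * B.tmul (normForm F E) x x = 0 := by
    rw [two_mul]
    nth_rewrite 1 [h]
    simp
  exact (mul_eq_zero.mp h3).resolve_left h2

lemma tmul_nondegenerate {B : LinearMap.BilinForm F V} (hB : B.Nondegenerate) (hA : B.IsAlt)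
    (hE : Module.finrank F E = 2) (h2 : (2 : F) ≠ 0) :
    LinearMap.BilinForm.Nondegenerate (B.tmul (normForm F E)) := by
  have hN := normForm_nondegenerate (F := F) (E := E) hE h2
  have hl : ∀ x, (∀ y, B.tmul (normForm F E) x y = 0) → x = 0 := by
    let φ := (TensorProduct.congr (B.toDual hB) ((normForm F E).toDual hN)).trans
      (TensorProduct.dualDistribEquiv F V E)
    have hφ : (φ : V ⊗[F] E →ₗ[F] Module.Dual F (V ⊗[F] E)) = B.tmul (normForm F E) := by
      ext a e b e'
      simp [φ, LinearMap.BilinForm.toDual_def, mul_comm,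
        TensorProduct.dualDistribEquiv, TensorProduct.dualDistribEquivOfBasis]
    intro x hx
    apply φ.injective
    rw [map_zero]
    have h : φ x = B.tmul (normForm F E) x := LinearMap.congr_fun hφ x
    rw [h]
    exact LinearMap.ext hx
  refine ⟨hl, fun x hx => hl x fun y => ?_⟩
  rw [← (tmul_isAlt hA hE h2).neg_eq, hx y, neg_zero]

/-- The subspace `L ⊗ E` of `V ⊗ E`. -/
def tensorSubmodule (E : Type*) [Field E] [Algebra F E] (L : Submodule F V) :
    Submodule F (V ⊗[F] E) :=
  LinearMap.range (L.subtype.rTensor E)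

lemma tmul_isotropic {B : LinearMap.BilinForm F V} {L : Submodule F V}
    (hL : ∀ a b : L, B a b = 0) (x y : V ⊗[F] E) (hx : x ∈ tensorSubmodule E L)
    (hy : y ∈ tensorSubmodule E L) : B.tmul (normForm F E) x y = 0 := by
  obtain ⟨x, rfl⟩ := hx
  obtain ⟨y, rfl⟩ := hy
  induction x with
  | zero => simp
  | add a b ha hb => simp only [map_add, LinearMap.add_apply, ha, hb, add_zero]
  | tmul a e =>
    induction y with
    | zero => simp
    | add a b ha hb => simp only [map_add, ha, hb, add_zero]
    | tmul b e' => simp [hL a b]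

lemma isCompl_tensorSubmodule {L L' : Submodule F V} (hc : IsCompl L L') :
    IsCompl (tensorSubmodule E L) (tensorSubmodule E L') := by
  have key : ∀ {L L' : Submodule F V} (hc : IsCompl L L') (x) (_ : x ∈ tensorSubmodule E L),
      (L.projectionOnto L' hc).rTensor E x = 0 → x = 0 := by
    rintro L L' hc _ ⟨x, rfl⟩ h
    rw [← LinearMap.rTensor_comp_apply, Submodule.projectionOnto_comp_subtype] at h
    simp only [LinearMap.rTensor_id, LinearMap.id_apply] at h
    rw [h, map_zero]
  refine ⟨Submodule.disjoint_def.mpr fun x hx hx' => key hc x hx ?_, codisjoint_iff.mpr ?_⟩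
  · obtain ⟨y, rfl⟩ := hx'
    rw [← LinearMap.rTensor_comp_apply]
    have h0 : L.projectionOnto L' hc ∘ₗ L'.subtype = 0 := by
      ext z
      simp
    rw [h0, LinearMap.rTensor_zero, LinearMap.zero_apply]
  · rw [eq_top_iff]
    intro x _
    induction x with
    | zero => exact zero_mem _
    | add a b ha hb => exact add_mem (ha trivial) (hb trivial)
    | tmul v e =>
      rw [← decomp hc v, TensorProduct.add_tmul]
      exact Submodule.add_mem_sup ⟨(L.projectionOnto L' hc v) ⊗ₜ e, rfl⟩
        ⟨(L'.projectionOnto L hc.symm v) ⊗ₜ e, rfl⟩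

lemma lagrangian_of_isotropic {M : Type*} [AddCommGroup M] [Module F M]
    {B : LinearMap.BilinForm F M} (hB : B.Nondegenerate) {A A' : Submodule F M}
    (hA : ∀ x y, x ∈ A → y ∈ A → B x y = 0) (hA' : ∀ x y, x ∈ A' → y ∈ A' → B x y = 0)
    (hc : IsCompl A A') : B.orthogonal A = A := by
  refine le_antisymm (fun x hx => ?_) fun x hx y hy => hA y x hy hx
  obtain ⟨a, ha, b, hb, rfl⟩ : ∃ a ∈ A, ∃ b ∈ A', a + b = x :=
    Submodule.mem_sup.mp (hc.sup_eq_top ▸ Submodule.mem_top)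
  have hb0 : b = 0 := by
    refine hB.2 b fun y => ?_
    obtain ⟨c, hcA, d, hd, rfl⟩ : ∃ c ∈ A, ∃ d ∈ A', c + d = y :=
      Submodule.mem_sup.mp (hc.sup_eq_top ▸ Submodule.mem_top)
    have h1 : B c (a + b) = 0 := hx c hcA
    rw [map_add, hA c a hcA ha, zero_add] at h1
    rw [map_add, LinearMap.add_apply, h1, hA' d b hd hb, add_zero]
  rw [hb0, add_zero]
  exact ha

/-- `V ⊗ E` with the product of the two forms is symplectic, with complementary Lagrangian
subspaces `L ⊗ E` and `L' ⊗ E`. -/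
lemma isPolarization_tensor {B : LinearMap.BilinForm F V} {L L' : Submodule F V}
    (hP : IsPolarization B L L') (hE : Module.finrank F E = 2) (h2 : (2 : F) ≠ 0) :
    IsPolarization (B.tmul (normForm F E)) (tensorSubmodule E L) (tensorSubmodule E L') := by
  have hn := tmul_nondegenerate hP.nondegenerate hP.isAlt hE h2
  have hc := isCompl_tensorSubmodule (E := E) hP.isCompl
  have h := tmul_isotropic (E := E) (form_isotropic_left hP)
  have h' := tmul_isotropic (E := E) (form_isotropic_right hP)
  exact ⟨tmul_isAlt hP.isAlt hE h2, hn, lagrangian_of_isotropic hn h h' hc,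
    lagrangian_of_isotropic hn h' h hc.symm, hc⟩

/-- The homomorphism `(g, t) ↦ g ⊗ t` from `Sp(V) × O(E)` to `Sp(V ⊗ E)`. -/
noncomputable def tensorHom (E : Type*) [Field E] [Algebra F E] [FiniteDimensional F E]
    (B : LinearMap.BilinForm F V) :
    isometryGroup B × isometryGroup (normForm F E) →*
      isometryGroup (B.tmul (normForm F E)) where
  toFun p := ⟨TensorProduct.congr p.1.1 p.2.1, fun x y => by
    induction x with
    | zero => simp
    | add a b ha hb => simp only [map_add, LinearMap.add_apply, ha, hb]
    | tmul a e =>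
      induction y with
      | zero => simp
      | add a b ha hb => simp only [map_add, ha, hb]
      | tmul b e' =>
        have h1 := p.1.2 a b
        have h3 := p.2.2 e e'
        simp [h1, h3]⟩
  map_one' := Subtype.ext (by
    refine LinearEquiv.toLinearMap_injective ?_
    ext a e
    simp)
  map_mul' p p' := Subtype.ext (by
    refine LinearEquiv.toLinearMap_injective ?_
    ext a e
    simp)

/-- The group `SO(E)`, as a subgroup of `O(E)`. -/
noncomputable def specialOrthogonal (F E : Type*) [Field F] [Fintype F] [Field E] [Algebra F E]
    [FiniteDimensional F E] : Subgroup (isometryGroup (normForm F E)) :=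
  (LinearEquiv.det.comp (isometryGroup (normForm F E)).subtype).ker

/-- The conjugation `x ↦ x ^ q`, as an element of `O(E)`. -/
noncomputable def conjugation (hE : Module.finrank F E = 2) : isometryGroup (normForm F E) :=
  ⟨(FiniteField.frobeniusAlgEquivOfAlgebraic F E).toLinearEquiv, fun x y => by
    apply FaithfulSMul.algebraMap_injective F E
    rw [algebraMap_normForm hE, algebraMap_normForm hE]
    simp only [AlgEquiv.toLinearEquiv_apply, FiniteField.coe_frobeniusAlgEquivOfAlgebraic,
      pow_card_pow_card hE]
    ring⟩

/-- The map `1 ⊗ t` on `L' ⊗ E`. -/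
noncomputable def tensorAct (L' : Submodule F V) (t : E ≃ₗ[F] E) (v : tensorSubmodule E L') :
    tensorSubmodule E L' :=
  ⟨TensorProduct.congr (LinearEquiv.refl F V) t v, by
    obtain ⟨_, x, rfl⟩ := v
    refine ⟨t.toLinearMap.lTensor L' x, ?_⟩
    induction x with
    | zero => simp
    | add a b ha hb => simp only [map_add, ha, hb]
    | tmul a e => simp⟩

variable {B : LinearMap.BilinForm F V} {L L' : Submodule F V}

/-- The Weil representation of `Sp(V ⊗ E)` attached to `ψ`, on the functions on `L' ⊗ E`. -/
noncomputable def weil (hP : IsPolarization B L L') (hE : Module.finrank F E = 2)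
    (h2 : (2 : F) ≠ 0) (ψ : AddChar F K) (hψ : ψ ≠ 1) :
    Representation K (isometryGroup (B.tmul (normForm F E))) (tensorSubmodule E L' → K) :=
  haveI : Finite (V ⊗[F] E) := Module.finite_of_finite F
  weilRepresentation (isPolarization_tensor hP hE h2) h2 ψ hψ

/-- The Weil representation, restricted to `Sp(V)`. -/
noncomputable def weilSp (hP : IsPolarization B L L') (hE : Module.finrank F E = 2)
    (h2 : (2 : F) ≠ 0) (ψ : AddChar F K) (hψ : ψ ≠ 1) :
    Representation K (isometryGroup B) (tensorSubmodule E L' → K) :=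
  (weil hP hE h2 ψ hψ).comp ((tensorHom E B).comp (MonoidHom.inl _ _))

/-- The Weil representation, restricted to `O(E)`. -/
noncomputable def weilO (hP : IsPolarization B L L') (hE : Module.finrank F E = 2)
    (h2 : (2 : F) ≠ 0) (ψ : AddChar F K) (hψ : ψ ≠ 1) :
    Representation K (isometryGroup (normForm F E)) (tensorSubmodule E L' → K) :=
  (weil hP hE h2 ψ hψ).comp ((tensorHom E B).comp (MonoidHom.inr _ _))

lemma weilO_weilSp (hP : IsPolarization B L L') (hE : Module.finrank F E = 2)
    (h2 : (2 : F) ≠ 0) (ψ : AddChar F K) (hψ : ψ ≠ 1) (t : isometryGroup (normForm F E))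
    (g : isometryGroup B) (f : tensorSubmodule E L' → K) :
    weilO hP hE h2 ψ hψ t (weilSp hP hE h2 ψ hψ g f)
      = weilSp hP hE h2 ψ hψ g (weilO hP hE h2 ψ hψ t f) := by
  have h : weilO hP hE h2 ψ hψ t * weilSp hP hE h2 ψ hψ g
      = weilSp hP hE h2 ψ hψ g * weilO hP hE h2 ψ hψ t := by
    simp only [weilO, weilSp, MonoidHom.comp_apply, MonoidHom.inl_apply, MonoidHom.inr_apply]
    rw [← map_mul, ← map_mul, ← map_mul, ← map_mul]
    simp
  exact LinearMap.congr_fun h f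

/-- `W_θ`, the `θ`-isotypic part of the Weil representation under `SO(E)`, as a representation
of `Sp(V)`. -/
noncomputable def isotypic (hP : IsPolarization B L L') (hE : Module.finrank F E = 2)
    (h2 : (2 : F) ≠ 0) (ψ : AddChar F K) (hψ : ψ ≠ 1) (θ : specialOrthogonal F E →* Kˣ) :
    Subrepresentation (weilSp hP hE h2 ψ hψ) where
  toSubmodule :=
    { carrier := {f | ∀ t : specialOrthogonal F E, weilO hP hE h2 ψ hψ t f = (θ t : K) • f}
      add_mem' := fun hf hg t => by rw [map_add, hf t, hg t, smul_add]
      zero_mem' := fun t => by rw [map_zero, smul_zero]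
      smul_mem' := fun c f hf t => by rw [map_smul, hf t, smul_comm] }
  apply_mem_toSubmodule g f hf t := by
    have h := hf t
    rw [weilO_weilSp, h, map_smul]

/-- The eigenspace with eigenvalue `ε = ±1` of the action of the conjugation on `W_θ`, as a
representation of `Sp(V)`. -/
noncomputable def isotypicSign (hP : IsPolarization B L L') (hE : Module.finrank F E = 2)
    (h2 : (2 : F) ≠ 0) (ψ : AddChar F K) (hψ : ψ ≠ 1) (θ : specialOrthogonal F E →* Kˣ) (ε : ℤˣ) :
    Subrepresentation (weilSp hP hE h2 ψ hψ) where
  toSubmodule :=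
    { carrier := {f | f ∈ (isotypic hP hE h2 ψ hψ θ).toSubmodule ∧
        weilO hP hE h2 ψ hψ (conjugation hE) f = (ε : ℤ) • f}
      add_mem' := fun hf hg => ⟨add_mem hf.1 hg.1, by rw [map_add, hf.2, hg.2, smul_add]⟩
      zero_mem' := ⟨zero_mem _, by rw [map_zero, smul_zero]⟩
      smul_mem' := fun c f hf =>
        ⟨Submodule.smul_mem _ c hf.1, by rw [map_smul, hf.2, smul_comm]⟩ }
  apply_mem_toSubmodule g f hf :=
    ⟨(isotypic hP hE h2 ψ hψ θ).apply_mem_toSubmodule g hf.1, by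
      rw [weilO_weilSp, hf.2, map_zsmul]⟩

/-- The set of orbits of `Sp(V)`, acting through the first factor, on `V ⊗ E`. -/
abbrev SpOrbits (E : Type*) [Field E] [Algebra F E] [FiniteDimensional F E]
    (B : LinearMap.BilinForm F V) : Type _ :=
  MulAction.orbitRel.Quotient
    (((isometryGroup (B.tmul (normForm F E))).subtype.comp
      ((tensorHom E B).comp (MonoidHom.inl _ _))).range) (V ⊗[F] E)

end Tensor

end Weil

/-! Everything rests on computing the commutant of Sp(V) in End(W) and recognising it as the image
of the group algebra of O(E).

The Heisenberg operators ρ(x), x ∈ V ⊗ E, form a basis of End(W) (`linearIndependent_heis`,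
`span_heis`), and conjugation by ω(g) sends ρ(x) to ρ(gx). So an operator commutes with Sp(V)
exactly when its coefficients are constant on Sp(V)-orbits, and the dimension of the commutant is
the number of orbits. A basis of E turns V ⊗ E into V × V with the diagonal action, and Witt's
theorem (`exists_isometry_pair`) lists the orbits of pairs (x, y): two with x = 0, q with y = cx and
x ≠ 0, and q with x, y independent, separated by ⟨x, y⟩. The total is 2q + 2 (`natCard_spOrbits`).

This is also the order of O(E), which is dihedral: SO(E) is the group of elements of norm 1, and x ↦
x^q inverts it. O(E) acts on W by moving the points of L' ⊗ E, with no extra scalar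
(`weilO_eq_functionAction`). It has a free orbit there, so its 2q + 2 operators are linearly
independent; they lie in the commutant and hence span it (`exists_eq_sum_weilO`).

Consequently every operator commuting with Sp(V) acts on W_θ as α + βΛ
(`exists_eq_add_conjugation`), and Λ carries W_θ to W_{θ⁻¹}. If θ ≠ θ⁻¹, such an operator preserving
W_θ is a scalar there; if θ = θ⁻¹, that is θ = 1 or ν, it is a scalar on each eigenspace of Λ.
Equivariant projections then give irreducibility. An isomorphism between two of the pieces extends
to an operator in the commutant, and the same formula limits where it can send W_θ or W_θ^±. -/

namespace Weil

/-! ### Equivariant projections and extensions for representations of finite groups -/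

section Subrepresentations

variable {K G W : Type*} [Field K] [CharZero K] [Group G] [Finite G] [AddCommGroup W] [Module K W]
  {ρ : Representation K G W}

/-- Every subrepresentation is the image of an equivariant projection. -/
lemma exists_equivariant_projection (S : Subrepresentation ρ) :
    ∃ X : Module.End K W, (∀ g, X * ρ g = ρ g * X) ∧ (∀ w, X w ∈ S.toSubmodule) ∧
      ∀ s ∈ S.toSubmodule, X s = s := by
  cases nonempty_fintype G
  obtain ⟨p, hp⟩ := S.toSubmodule.exists_isCompl
  set π : Module.End K W := S.toSubmodule.subtype ∘ₗ S.toSubmodule.projectionOnto p hp with hπ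
  have hmem : ∀ w, π w ∈ S.toSubmodule := fun w => by simp [hπ]
  have hid : ∀ s ∈ S.toSubmodule, π s = s := fun s hs => by
    have := Submodule.projectionOnto_apply_left hp ⟨s, hs⟩
    simp [hπ, this]
  have hG : (Fintype.card G : K) ≠ 0 := Nat.cast_ne_zero.mpr Fintype.card_ne_zero
  refine ⟨(Fintype.card G : K)⁻¹ • ∑ g, ρ g * π * ρ g⁻¹, fun h => ?_, fun w => ?_, fun s hs => ?_⟩
  · rw [smul_mul_assoc, mul_smul_comm, Finset.sum_mul, Finset.mul_sum]
    congr 1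
    refine (Fintype.sum_equiv (Equiv.mulLeft h) _ _ fun g => ?_).symm
    simp only [Equiv.coe_mulLeft, mul_inv_rev, map_mul, mul_assoc]
    rw [← map_mul ρ h⁻¹ h]
    simp
  · simp only [LinearMap.smul_apply, LinearMap.sum_apply, Module.End.mul_apply]
    exact Submodule.smul_mem _ _ (Submodule.sum_mem _ fun g _ => S.apply_mem_toSubmodule g (hmem _))
  · have h1 : ∀ g, (ρ g * π * ρ g⁻¹) s = s := fun g => by
      simp only [Module.End.mul_apply]
      rw [hid _ (S.apply_mem_toSubmodule _ hs), ← Module.End.mul_apply, ← map_mul]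
      simp
    simp only [LinearMap.smul_apply, LinearMap.sum_apply, h1, Finset.sum_const, Finset.card_univ]
    rw [← Nat.cast_smul_eq_nsmul K, smul_smul, inv_mul_cancel₀ hG, one_smul]

/-- A nonzero subrepresentation is irreducible if every equivariant endomorphism that preserves it
acts on it as a scalar. -/
lemma isIrreducible_of_scalar (S : Subrepresentation ρ) (hS : S.toSubmodule ≠ ⊥)
    (h : ∀ X : Module.End K W, (∀ g, X * ρ g = ρ g * X) →
      (∀ s ∈ S.toSubmodule, X s ∈ S.toSubmodule) → ∃ α : K, ∀ s ∈ S.toSubmodule, X s = α • s) :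
    S.toRepresentation.IsIrreducible := by
  have hnt : Nontrivial (Subrepresentation S.toRepresentation) := by
    refine ⟨⊥, ⊤, fun h0 => hS ?_⟩
    rw [Submodule.eq_bot_iff]
    intro s hs
    have h1 : (⟨s, hs⟩ : S.toSubmodule) ∈ (⊤ : Subrepresentation S.toRepresentation).toSubmodule :=
      Submodule.mem_top
    rw [← h0] at h1
    have h2 : (⟨s, hs⟩ : S.toSubmodule) = 0 := (Submodule.mem_bot K).mp h1
    simpa using h2
  refine ⟨fun R => or_iff_not_imp_left.mpr fun hR => ?_⟩
  let R' : Subrepresentation ρ :=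
    ⟨R.toSubmodule.map S.toSubmodule.subtype, by
      rintro g _ ⟨r, hr, rfl⟩
      exact ⟨_, R.apply_mem_toSubmodule g hr, rfl⟩⟩
  -- The projection onto R' acts on S as a scalar and fixes a nonzero vector of R', so the scalar is
  -- 1 and R' exhausts S. No eigenvalue is needed.
  obtain ⟨X, hX, hXm, hXi⟩ := exists_equivariant_projection R'
  have hle : R'.toSubmodule ≤ S.toSubmodule := Submodule.map_subtype_le _ _
  obtain ⟨α, hα⟩ := h X hX fun s _ => hle (hXm s)
  obtain ⟨r, hr, hr0⟩ : ∃ r ∈ R.toSubmodule, r ≠ 0 := by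
    refine Submodule.exists_mem_ne_zero_of_ne_bot fun h0 => hR ?_
    exact Subrepresentation.toSubmodule_injective h0
  have h1 : (r : W) = α • (r : W) := by
    rw [← hα r r.2, hXi r ⟨r, hr, rfl⟩]
  have hα1 : α = 1 := by
    have h2 : (1 - α) • (r : W) = 0 := by rw [sub_smul, one_smul, ← h1, sub_self]
    have h3 : (r : W) ≠ 0 := by simpa using hr0
    exact (sub_eq_zero.mp ((smul_eq_zero.mp h2).resolve_right h3)).symm
  refine Subrepresentation.toSubmodule_injective (eq_top_iff.mpr fun s _ => ?_)
  obtain ⟨r', hr', h4⟩ := hXm (s : W)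
  rw [hα s s.2, hα1, one_smul] at h4
  rwa [Subtype.ext h4] at hr'

/-- An isomorphism of subrepresentations extends to an equivariant endomorphism. -/
lemma exists_equivariant_extension {S S' : Subrepresentation ρ}
    (φ : S.toRepresentation.Equiv S'.toRepresentation) :
    ∃ X : Module.End K W, (∀ g, X * ρ g = ρ g * X) ∧
      ∀ s ∈ S.toSubmodule, X s ∈ S'.toSubmodule ∧ (X s = 0 → s = 0) := by
  obtain ⟨P, hP, hPm, hPi⟩ := exists_equivariant_projection S
  let X : Module.End K W := S'.toSubmodule.subtype ∘ₗ φ.toLinearMap ∘ₗ P.codRestrict _ hPm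
  have hX : ∀ s : S.toSubmodule, X s = φ s := fun s => by
    have : P.codRestrict _ hPm (s : W) = s := Subtype.ext (hPi s s.2)
    simp only [X, LinearMap.comp_apply, this]
    rfl
  refine ⟨X, fun g => LinearMap.ext fun w => ?_, fun s hs => ⟨?_, fun h0 => ?_⟩⟩
  · have h1 : P.codRestrict _ hPm (ρ g w) = S.toRepresentation g (P.codRestrict _ hPm w) :=
      Subtype.ext (LinearMap.congr_fun (hP g) w)
    simp only [X, LinearMap.comp_apply, Module.End.mul_apply]
    rw [h1]
    exact congrArg Subtype.val (φ.toIntertwiningMap.isIntertwining _ _ g (P.codRestrict _ hPm w))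
  · rw [hX ⟨s, hs⟩]
    exact (φ ⟨s, hs⟩).2
  · rw [hX ⟨s, hs⟩] at h0
    have h1 : φ ⟨s, hs⟩ = φ 0 := by rw [map_zero]; exact Subtype.ext h0
    simpa using EquivLike.injective φ h1

end Subrepresentations

/-! ### The Heisenberg operators as a basis of End(W), and the commutant of a group -/

section HeisenbergBasis

variable {F K M : Type*} [Field F] [Field K] [AddCommGroup M] [Module F M]
  {B : LinearMap.BilinForm F M} {A A' : Submodule F M}

lemma IsPolarization.symm (hP : IsPolarization B A A') : IsPolarization B A' A :=
  ⟨hP.isAlt, hP.nondegenerate, hP.lagrangian_right, hP.lagrangian_left, hP.isCompl.symm⟩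

/-- The form embeds A' in the dual of A. -/
lemma IsPolarization.finrank_le [FiniteDimensional F M] (hP : IsPolarization B A A') :
    Module.finrank F A' ≤ Module.finrank F A := by
  let φ : A' →ₗ[F] Module.Dual F A :=
    { toFun := fun v => (B.flip (v : M)).comp A.subtype
      map_add' := fun v w => by ext; simp
      map_smul' := fun c v => by ext; simp }
  have hφ : Function.Injective φ := by
    rw [injective_iff_map_eq_zero]
    intro v hv
    exact eq_zero_of_pairing hP v fun a => by simpa [φ] using LinearMap.congr_fun hv a
  simpa [Subspace.dual_finrank_eq] using LinearMap.finrank_le_finrank_of_injective hφ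

lemma IsPolarization.finrank_eq [FiniteDimensional F M] (hP : IsPolarization B A A') :
    Module.finrank F A' = Module.finrank F A :=
  le_antisymm hP.finrank_le hP.symm.finrank_le

variable [Finite M]

lemma IsPolarization.natCard_eq (hP : IsPolarization B A A') :
    Nat.card M = Nat.card A' * Nat.card A' := by
  have : FiniteDimensional F M := inferInstance
  have e1 : (A × A') ≃ₗ[F] M := Submodule.prodEquivOfIsCompl A A' hP.isCompl
  have e2 : A' ≃ₗ[F] A := LinearEquiv.ofFinrankEq _ _ hP.finrank_eq
  rw [← Nat.card_congr e1.toEquiv, Nat.card_prod, Nat.card_congr e2.toEquiv]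

variable [CharZero K]

/-- Conjugation by ρ(y) multiplies ρ(x) by ψ(B(y, x)). As B is nondegenerate, different x give
different characters of M, and eigenvectors for different characters are independent. -/
lemma linearIndependent_heis (hP : IsPolarization B A A') (ψ : AddChar F K) (hψ : ψ ≠ 1)
    (h2 : (2 : F) ≠ 0) : LinearIndependent K (heis B hP.isCompl ψ) := by
  classical
  cases nonempty_fintype M
  set ρ := heis B hP.isCompl ψ with hρ
  have hmul : ∀ x y, ρ x * ρ y = ψ (2⁻¹ * B x y) • ρ (x + y) := heis_mul hP ψ h2
  rw [Fintype.linearIndependent_iff]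
  intro c hc z
  have hconj : ∀ y x, ρ y * ρ x * ρ (-y) = ψ (B y x) • ρ x := by
    intro y x
    have e1 : y + x + -y = x := by abel
    have e2 : 2⁻¹ * B y x + 2⁻¹ * B (y + x) (-y) = B y x := by
      simp only [map_neg, map_add, LinearMap.add_apply]
      rw [hP.isAlt.self_eq_zero, ← hP.isAlt.neg_eq y x]
      field_simp
      ring
    rw [hmul, smul_mul_assoc, hmul, smul_smul, ← AddChar.map_add_eq_mul, e1, e2]
  -- Fourier inversion: averaging the conjugates of a vanishing combination against ψ(-B(y, z))
  -- leaves only the term x = z.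
  have h3 : ∑ y : M, ψ (-B y z) • (ρ y * (∑ x : M, c x • ρ x) * ρ (-y))
      = ((Fintype.card M : K) * c z) • ρ z := by
    simp only [Finset.mul_sum, Finset.sum_mul, mul_smul_comm, smul_mul_assoc, hconj,
      Finset.smul_sum]
    rw [Finset.sum_comm]
    have h4 : ∀ x : M, ∑ y : M, ψ (-B y z) • c x • ψ (B y x) • ρ x
        = if x = z then ((Fintype.card M : K) * c z) • ρ z else 0 := by
      intro x
      have h5 := sum_char ψ hψ (B.flip (x - z))
      have h6 : ∀ y : M, ψ (-B y z) • c x • ψ (B y x) • ρ x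
          = ψ (B.flip (x - z) y) • (c x • ρ x) := fun y => by
        rw [smul_comm (c x), smul_smul, ← AddChar.map_add_eq_mul]
        congr 2
        simp [LinearMap.BilinForm.flip_apply]
        ring
      simp only [h6, ← Finset.sum_smul]
      rw [h5]
      have h8 : B.flip (x - z) = 0 ↔ x = z := by
        refine ⟨fun h9 => ?_, fun h9 => by simp [h9]⟩
        exact sub_eq_zero.mp (hP.nondegenerate.2 (x - z) fun y => by
          simpa [LinearMap.BilinForm.flip_apply] using LinearMap.congr_fun h9 y)
      simp only [h8]
      split_ifs with h
      · rw [h, smul_smul]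
      · rw [zero_smul]
    simp [h4]
  rw [hc] at h3
  simp only [mul_zero, zero_mul, smul_zero, Finset.sum_const_zero] at h3
  -- ρ(z) is invertible, since ρ(z)ρ(-z) = 1.
  have hz : ρ z ≠ 0 := by
    intro h0
    have h9 := hmul z (-z)
    rw [h0, zero_mul, map_neg, hP.isAlt.self_eq_zero] at h9
    simp [hρ, heis_zero] at h9
  exact (mul_eq_zero.mp ((smul_eq_zero.mp h3.symm).resolve_right hz)).resolve_left
    (Nat.cast_ne_zero.mpr Fintype.card_ne_zero)

/-- By independence it is enough to count: |M| = |A'|² = dim End(W). -/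
lemma span_heis (hP : IsPolarization B A A') (ψ : AddChar F K) (hψ : ψ ≠ 1) (h2 : (2 : F) ≠ 0) :
    Submodule.span K (Set.range (heis B hP.isCompl ψ)) = ⊤ := by
  cases nonempty_fintype M
  cases nonempty_fintype A'
  refine (linearIndependent_heis hP ψ hψ h2).span_eq_top_of_card_eq_finrank' ?_
  rw [Module.finrank_linearMap, Module.finrank_fintype_fun_eq_card, ← Nat.card_eq_fintype_card,
    hP.natCard_eq, Nat.card_eq_fintype_card]

/-- The endomorphisms of the Weil representation that commute with the action of a group `H` have
a basis indexed by the orbits of `H`. -/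
lemma finrank_intertwiningMap_weilRepresentation {H : Type*} [Group H]
    (hP : IsPolarization B A A') (h2 : (2 : F) ≠ 0) (ψ : AddChar F K) (hψ : ψ ≠ 1)
    (σ : H →* isometryGroup B) :
    Module.finrank K (Representation.IntertwiningMap
        ((weilRepresentation hP h2 ψ hψ).comp σ : Representation K H (A' → K))
        ((weilRepresentation hP h2 ψ hψ).comp σ : Representation K H (A' → K)))
      = Nat.card (MulAction.orbitRel.Quotient ((isometryGroup B).subtype.comp σ).range M) := by
  classical
  cases nonempty_fintype M
  set ω : Representation K H (A' → K) := (weilRepresentation hP h2 ψ hψ).comp σ with hω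
  set R := ((isometryGroup B).subtype.comp σ).range with hR
  set ρ := heis B hP.isCompl ψ with hρ
  have hint : ∀ h x, ω h * ρ x = ρ ((σ h).1 x) * ω h := fun h x =>
    weilRepresentation_intertwines hP h2 ψ hψ (σ h) x
  have hli := linearIndependent_heis hP ψ hψ h2
  let cls : M → MulAction.orbitRel.Quotient R M := fun x => Quotient.mk'' x
  have hcls : ∀ h x, cls ((σ h).1 x) = cls x := fun h x =>
    Quotient.sound' (show _ ∈ MulAction.orbit R x from ⟨⟨(σ h).1, ⟨h, rfl⟩⟩, rfl⟩)
  -- A function on the set of orbits gives the combination of the ρ(x) with these coefficients; Φ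
  -- will be shown bijective.
  let Φ : (MulAction.orbitRel.Quotient R M → K) →ₗ[K] Representation.IntertwiningMap ω ω :=
    { toFun := fun c => ⟨∑ x, c (cls x) • ρ x, fun h => by
        change (∑ x, c (cls x) • ρ x) * ω h = ω h * ∑ x, c (cls x) • ρ x
        simp only [Finset.sum_mul, Finset.mul_sum, mul_smul_comm, smul_mul_assoc, hint]
        refine (Fintype.sum_equiv (σ h).1.toEquiv _ _ fun x => ?_).symm
        change _ = c (cls ((σ h).1 x)) • _
        rw [hcls]
        rfl⟩
      map_add' := fun c d => by
        apply Representation.IntertwiningMap.ext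
        change ∑ x, (c (cls x) + d (cls x)) • ρ x = ∑ x, c (cls x) • ρ x + ∑ x, d (cls x) • ρ x
        simp only [add_smul, Finset.sum_add_distrib]
      map_smul' := fun a c => by
        apply Representation.IntertwiningMap.ext
        change ∑ x, (a * c (cls x)) • ρ x = a • ∑ x, c (cls x) • ρ x
        simp only [mul_smul, Finset.smul_sum] }
  have hΦ : ∀ c, (Φ c).toLinearMap = ∑ x, c (cls x) • ρ x := fun c => rfl
  have hinj : Function.Injective Φ := by
    rw [injective_iff_map_eq_zero]
    intro c hc
    have h1 : ∑ x, c (cls x) • ρ x = 0 := by rw [← hΦ, hc]; rfl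
    ext o
    induction o using Quotient.inductionOn' with
    | h x => exact Fintype.linearIndependent_iff.mp hli _ h1 x
  have hsurj : Function.Surjective Φ := by
    intro T
    have h1 : T.toLinearMap ∈ Submodule.span K (Set.range ρ) := by
      rw [hρ, span_heis hP ψ hψ h2]; trivial
    obtain ⟨a, ha⟩ := (Submodule.mem_span_range_iff_exists_fun K).mp h1
    have hinv : ∀ h x, a ((σ h).1 x) = a x := by
      intro h
      have h3 : T.toLinearMap * ω h = ω h * T.toLinearMap := T.isIntertwining' h
      have hu : ω h * ω h⁻¹ = 1 := by rw [← map_mul]; simp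
      -- The left side is T after reindexing and the right side is the conjugate of T by ω(h). They
      -- agree, and independence of the ρ(x) makes the coefficients of T invariant.
      have h4 : ∑ x, a ((σ h).1 x) • ρ ((σ h).1 x) = ∑ x, a x • ρ ((σ h).1 x) := by
        have h6 : ∑ x, a ((σ h).1 x) • ρ ((σ h).1 x) = ∑ x, a x • ρ x :=
          Fintype.sum_equiv (σ h).1.toEquiv _ _ fun x => rfl
        have h5 : (∑ x, a x • ρ x) * ω h = (∑ x, a x • ρ ((σ h).1 x)) * ω h := by
          rw [ha, h3, ← ha]
          simp only [Finset.sum_mul, Finset.mul_sum, mul_smul_comm, smul_mul_assoc, hint]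
        have h7 := congrArg (· * ω h⁻¹) h5
        simp only [mul_assoc, hu, mul_one] at h7
        rw [h6, h7]
      exact Fintype.linearIndependent_iffₛ.mp (hli.comp (σ h).1 (σ h).1.injective) _ _ h4
    refine ⟨fun o => Quotient.liftOn' o a ?_, ?_⟩
    · rintro _ y ⟨⟨_, h, rfl⟩, rfl⟩
      exact hinv h y
    · apply Representation.IntertwiningMap.ext
      rw [hΦ, ← ha]
      rfl
  have : Finite (MulAction.orbitRel.Quotient R M) := Quotient.finite _
  cases nonempty_fintype (MulAction.orbitRel.Quotient R M)
  rw [← (LinearEquiv.ofBijective Φ ⟨hinj, hsurj⟩).finrank_eq, Module.finrank_fintype_fun_eq_card,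
    Nat.card_eq_fintype_card]

end HeisenbergBasis

/-! ### The orthogonal group of E: rotations, conjugation, order and characters -/

section OrthogonalGroup

variable {F E : Type*} [Field F] [Fintype F] [Field E] [Algebra F E] [FiniteDimensional F E]

lemma conjugation_apply (hE : Module.finrank F E = 2) (x : E) :
    (conjugation (F := F) hE).1 x = x ^ Fintype.card F := by
  change FiniteField.frobeniusAlgEquivOfAlgebraic F E x = _
  rw [FiniteField.coe_frobeniusAlgEquivOfAlgebraic]

lemma conjugation_mul_self (hE : Module.finrank F E = 2) :
    conjugation (F := F) hE * conjugation hE = 1 := by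
  refine Subtype.ext (LinearEquiv.ext fun x => ?_)
  change (conjugation hE).1 ((conjugation hE).1 x) = x
  rw [conjugation_apply, conjugation_apply, pow_card_pow_card hE]

/-- There is a basis of `E` consisting of `1` and an element of trace `0`. -/
lemma exists_anti_invariant (hE : Module.finrank F E = 2) (h2 : (2 : F) ≠ 0) :
    ∃ d : E, d ≠ 0 ∧ d ^ Fintype.card F = -d ∧
      Submodule.span F {1, d} = ⊤ ∧ LinearIndependent F ![1, d] := by
  -- The trace maps a plane to a line, so it has a nonzero kernel vector d, and trace zero means d^q
  -- = -d.
  obtain ⟨d, hd, hd0⟩ := Submodule.exists_mem_ne_zero_of_ne_bot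
    (LinearMap.ker_ne_bot_of_finrank_lt (f := Algebra.trace F E) (by simp [hE]))
  have h1 : d ^ Fintype.card F = -d := by
    have h3 := trace_quadratic hE d
    rw [LinearMap.mem_ker.mp hd, map_zero] at h3
    linear_combination -h3
  have h2E : (2 : E) ≠ 0 := by
    rw [← map_ofNat (algebraMap F E) 2]
    simpa using h2
  have hli : LinearIndependent F ![1, d] := by
    rw [LinearIndependent.pair_iff]
    intro s t hst
    -- Frobenius applied to the relation s + td = 0.
    have h3 : s • (1 : E) - t • d = 0 := by
      have h4 := congrArg (FiniteField.frobeniusAlgEquivOfAlgebraic F E) hst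
      simp only [map_add, map_smul, map_one, map_zero,
        FiniteField.coe_frobeniusAlgEquivOfAlgebraic, h1] at h4
      rw [← h4]
      simp [sub_eq_add_neg]
    have h5 : (2 : F) • (t • d) = 0 := by rw [two_smul]; linear_combination hst - h3
    have ht : t = 0 := by
      rcases smul_eq_zero.mp h5 with h | h
      · exact absurd h h2
      · exact (smul_eq_zero.mp h).resolve_right hd0
    rw [ht, zero_smul, add_zero] at hst
    exact ⟨(smul_eq_zero.mp hst).resolve_right one_ne_zero, ht⟩
  refine ⟨d, hd0, h1, ?_, hli⟩
  have h6 := hli.span_eq_top_of_card_eq_finrank' (by simp [hE])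
  rw [Set.pair_comm]
  simpa using h6

/-- Multiplication by an element of norm `1`. -/
noncomputable def rotation (hE : Module.finrank F E = 2) :
    rootsOfUnity (Fintype.card F + 1) E →* isometryGroup (normForm F E) where
  toFun u := ⟨DistribMulAction.toModuleAut F E (u : Eˣ), fun x y => by
    have hu : ((u : Eˣ) : E) ^ (Fintype.card F + 1) = 1 := (mem_rootsOfUnity' _ _).mp u.2
    apply FaithfulSMul.algebraMap_injective F E
    rw [algebraMap_normForm hE, algebraMap_normForm hE]
    simp only [DistribMulAction.toModuleAut_apply, DistribMulAction.toLinearEquiv_apply,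
      Units.smul_def, smul_eq_mul, mul_pow]
    rw [pow_succ] at hu
    linear_combination (2⁻¹ * (x * y ^ Fintype.card F + x ^ Fintype.card F * y)) * hu⟩
  map_one' := Subtype.ext (map_one (DistribMulAction.toModuleAut F E))
  map_mul' u v := Subtype.ext (map_mul (DistribMulAction.toModuleAut F E) (u : Eˣ) (v : Eˣ))

lemma rotation_apply (hE : Module.finrank F E = 2) (u : rootsOfUnity (Fintype.card F + 1) E)
    (x : E) : (rotation hE u).1 x = ((u : Eˣ) : E) * x := rfl

lemma rotation_injective (hE : Module.finrank F E = 2) :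
    Function.Injective (rotation (F := F) (E := E) hE) := by
  intro u v huv
  have h := LinearEquiv.congr_fun (congrArg Subtype.val huv) 1
  rw [rotation_apply, rotation_apply, mul_one, mul_one] at h
  exact Subtype.ext (Units.ext h)

/-- The determinant of multiplication by u is its norm u^(1+q). -/
lemma rotation_mem (hE : Module.finrank F E = 2) (u : rootsOfUnity (Fintype.card F + 1) E) :
    rotation hE u ∈ specialOrthogonal F E := by
  have hu : ((u : Eˣ) : E) ^ (Fintype.card F + 1) = 1 := (mem_rootsOfUnity' _ _).mp u.2
  have : Finite E := Module.finite_of_finite F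
  change LinearEquiv.det (rotation hE u).1 = 1
  apply Units.ext
  rw [LinearEquiv.coe_det]
  have h1 : ((rotation hE u).1 : E →ₗ[F] E) = LinearMap.mulLeft F ((u : Eˣ) : E) :=
    LinearMap.ext fun x => rfl
  rw [h1]
  change Algebra.norm F ((u : Eˣ) : E) = 1
  apply FaithfulSMul.algebraMap_injective F E
  rw [FiniteField.algebraMap_norm_eq_pow_sum, hE, map_one, ← hu]
  simp [Finset.sum_range_succ, Nat.card_eq_fintype_card, add_comm]

/-- In the basis 1, d the conjugation is diag(1, -1), and -1 ≠ 1 in F. -/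
lemma conjugation_notMem (hE : Module.finrank F E = 2) (h2 : (2 : F) ≠ 0) :
    conjugation hE ∉ specialOrthogonal F E := by
  obtain ⟨d, hd0, hd, hsp, hli⟩ := exists_anti_invariant hE h2
  intro h
  have h1 : LinearMap.det ((conjugation (F := F) hE).1 : E →ₗ[F] E) = 1 := by
    have h3 : LinearEquiv.det (conjugation (F := F) hE).1 = 1 := h
    rw [← LinearEquiv.coe_det, h3, Units.val_one]
  let b := basisOfLinearIndependentOfCardEqFinrank hli (by simp [hE])
  have hb0 : b 0 = 1 := by simp [b]
  have hb1 : b 1 = d := by simp [b]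
  have hc0 : (conjugation (F := F) hE).1 (b 0) = b 0 := by rw [conjugation_apply, hb0, one_pow]
  have hc1 : (conjugation (F := F) hE).1 (b 1) = -b 1 := by rw [conjugation_apply, hb1, hd]
  rw [← LinearMap.det_toMatrix b, Matrix.det_fin_two] at h1
  simp only [LinearMap.toMatrix_apply, LinearEquiv.coe_coe, hc0, hc1, map_neg,
    Module.Basis.repr_self, Finsupp.neg_apply] at h1
  simp at h1
  apply h2
  linear_combination -h1

/-- The image of 1 has norm 1, so dividing by a rotation leaves an isometry s fixing 1. As d is
orthogonal to 1, so is s(d); this and the preserved length force s(d) = ±d, and s is the identity or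
the conjugation. -/
lemma isometry_eq (hE : Module.finrank F E = 2) (h2 : (2 : F) ≠ 0)
    (t : isometryGroup (normForm F E)) :
    ∃ u, t = rotation hE u ∨ t = rotation hE u * conjugation hE := by
  obtain ⟨d, hd0, hd, hsp, -⟩ := exists_anti_invariant hE h2
  have h2E : (2 : E) ≠ 0 := by
    rw [← map_ofNat (algebraMap F E) 2]
    simpa using h2
  have key : ∀ (s : isometryGroup (normForm F E)) (x y : E),
      s.1 x * s.1 y ^ Fintype.card F + s.1 x ^ Fintype.card F * s.1 y
        = x * y ^ Fintype.card F + x ^ Fintype.card F * y := by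
    intro s x y
    have h := congrArg (algebraMap F E) (s.2 x y)
    rw [algebraMap_normForm hE, algebraMap_normForm hE] at h
    exact mul_left_cancel₀ (inv_ne_zero h2E) h
  have h1 : t.1 1 ^ (Fintype.card F + 1) = 1 := by
    have h := key t 1 1
    refine mul_left_cancel₀ h2E ?_
    simp only [one_pow, mul_one] at h
    rw [pow_succ]
    linear_combination h
  let v : rootsOfUnity (Fintype.card F + 1) E :=
    ⟨(IsUnit.of_pow_eq_one h1 (by simp)).unit, by
      rw [mem_rootsOfUnity']
      simpa using h1⟩
  have hv : ((v : Eˣ) : E) = t.1 1 := rfl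
  set s := (rotation hE v)⁻¹ * t with hs
  have hts : t = rotation hE v * s := by rw [hs, mul_inv_cancel_left]
  have hs1 : s.1 1 = 1 := by
    have h3 := congrArg (fun r : isometryGroup (normForm F E) => r.1 1) hts
    change t.1 1 = (rotation hE v).1 (s.1 1) at h3
    rw [rotation_apply, hv] at h3
    have h4 : t.1 1 ≠ 0 := by
      intro h0
      rw [h0] at h1
      simp at h1
    exact (mul_left_cancel₀ h4 ((mul_one _).trans h3)).symm
  have hsd : s.1 d ^ Fintype.card F = -s.1 d := by
    have h3 := key s 1 d
    rw [hs1, hd] at h3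
    simp only [one_pow] at h3
    linear_combination h3
  have hsd2 : s.1 d = d ∨ s.1 d = -d := by
    rw [← sq_eq_sq_iff_eq_or_eq_neg]
    have h3 := key s d d
    rw [hsd, hd] at h3
    refine mul_left_cancel₀ h2E ?_
    linear_combination -h3
  have hext : ∀ r : isometryGroup (normForm F E), s.1 1 = r.1 1 → s.1 d = r.1 d → s = r := by
    intro r h3 h4
    refine Subtype.ext (LinearEquiv.toLinearMap_injective (LinearMap.ext_on hsp ?_))
    rintro x (rfl | rfl)
    · exact h3
    · exact h4
  refine ⟨v, hsd2.imp (fun h => ?_) fun h => ?_⟩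
  · rw [hts, hext 1 hs1 h, mul_one]
  · rw [hts, hext (conjugation hE) (by rw [hs1, conjugation_apply, one_pow])
      (by rw [h, conjugation_apply, hd])]

lemma mem_or_conjugation_mul_mem (hE : Module.finrank F E = 2) (h2 : (2 : F) ≠ 0)
    (t : isometryGroup (normForm F E)) :
    t ∈ specialOrthogonal F E ∨ conjugation hE * t ∈ specialOrthogonal F E := by
  obtain ⟨u, rfl | rfl⟩ := isometry_eq hE h2 t
  · exact Or.inl (rotation_mem hE u)
  · refine Or.inr ?_
    have : (specialOrthogonal F E).Normal := by
      unfold specialOrthogonal; infer_instance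
    have h := this.conj_mem _ (rotation_mem hE u) (conjugation hE)
    rwa [inv_eq_of_mul_eq_one_right (conjugation_mul_self hE), mul_assoc] at h

lemma rotation_mul_conjugation_mul_self (hE : Module.finrank F E = 2)
    (u : rootsOfUnity (Fintype.card F + 1) E) :
    rotation hE u * conjugation hE * (rotation hE u * conjugation hE) = 1 := by
  have hu : ((u : Eˣ) : E) ^ (Fintype.card F + 1) = 1 := (mem_rootsOfUnity' _ _).mp u.2
  refine Subtype.ext (LinearEquiv.ext fun x => ?_)
  change (rotation hE u).1 ((conjugation hE).1 ((rotation hE u).1 ((conjugation hE).1 x))) = x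
  rw [rotation_apply, rotation_apply, conjugation_apply, conjugation_apply, mul_pow,
    pow_card_pow_card hE, ← mul_assoc, ← pow_succ', hu, one_mul]

/-- Every isometry of `E` is an involution or a product of two involutions. -/
lemma exists_involutions (hE : Module.finrank F E = 2) (h2 : (2 : F) ≠ 0)
    (t : isometryGroup (normForm F E)) :
    ∃ r s : isometryGroup (normForm F E), r * r = 1 ∧ s * s = 1 ∧ t = r * s := by
  obtain ⟨u, rfl | rfl⟩ := isometry_eq hE h2 t
  · exact ⟨_, _, rotation_mul_conjugation_mul_self hE u, conjugation_mul_self hE, by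
      rw [mul_assoc, conjugation_mul_self, mul_one]⟩
  · exact ⟨_, 1, rotation_mul_conjugation_mul_self hE u, one_mul 1, (mul_one _).symm⟩

lemma rotation_surjective (hE : Module.finrank F E = 2) (h2 : (2 : F) ≠ 0)
    (t : specialOrthogonal F E) : ∃ u, rotation hE u = t := by
  obtain ⟨u, h | h⟩ := isometry_eq hE h2 t.1
  · exact ⟨u, h.symm⟩
  · refine absurd ?_ (conjugation_notMem hE h2)
    have h3 := mul_mem (inv_mem (rotation_mem hE u)) t.2
    rwa [h, inv_mul_cancel_left] at h3

/-- The dihedral relation: tσ is an involution for every rotation t. It is the reason why Λ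
exchanges W_θ and W_{θ⁻¹}. -/
lemma mul_conjugation (hE : Module.finrank F E = 2) (h2 : (2 : F) ≠ 0)
    (t : specialOrthogonal F E) : (t : isometryGroup (normForm F E)) * conjugation hE
      = conjugation hE * ((t⁻¹ : specialOrthogonal F E) : isometryGroup (normForm F E)) := by
  obtain ⟨u, hu⟩ := rotation_surjective hE h2 t
  have h := rotation_mul_conjugation_mul_self hE u
  rw [hu] at h
  rw [eq_inv_of_mul_eq_one_left h, mul_inv_rev,
    inv_eq_of_mul_eq_one_right (conjugation_mul_self hE)]
  rfl

/-- `SO(E)` is the group of elements of `E` of norm `1`. -/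
noncomputable def rotationEquiv (hE : Module.finrank F E = 2) (h2 : (2 : F) ≠ 0) :
    rootsOfUnity (Fintype.card F + 1) E ≃* specialOrthogonal F E :=
  MulEquiv.ofBijective ((rotation hE).codRestrict (specialOrthogonal F E) (rotation_mem hE))
    ⟨fun _ _ h => rotation_injective hE (congrArg Subtype.val h), fun t => by
      obtain ⟨u, hu⟩ := rotation_surjective hE h2 t
      exact ⟨u, Subtype.ext hu⟩⟩

lemma isCyclic_specialOrthogonal (hE : Module.finrank F E = 2) (h2 : (2 : F) ≠ 0) :
    IsCyclic (specialOrthogonal F E) :=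
  isCyclic_of_surjective (rotationEquiv hE h2) (rotationEquiv hE h2).surjective

lemma natCard_specialOrthogonal (hE : Module.finrank F E = 2) (h2 : (2 : F) ≠ 0) :
    Nat.card (specialOrthogonal F E) = Fintype.card F + 1 := by
  have : Finite E := Module.finite_of_finite F
  rw [← Nat.card_congr (rotationEquiv hE h2).toEquiv]
  have h1 : rootsOfUnity (Fintype.card F + 1) E
      = (powMonoidHom (Fintype.card F + 1) : Eˣ →* Eˣ).ker := by
    ext; simp [MonoidHom.mem_ker]
  have h3 : Nat.card Eˣ = (Fintype.card F + 1) * (Fintype.card F - 1) := by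
    rw [Nat.card_units, Module.natCard_eq_pow_finrank (K := F), hE, Nat.card_eq_fintype_card]
    simpa using Nat.sq_sub_sq (Fintype.card F) 1
  -- Eˣ is cyclic of order (q + 1)(q - 1), so x^(q+1) = 1 has gcd(q + 1, (q + 1)(q - 1)) = q + 1
  -- solutions.
  rw [h1, IsCyclic.card_powMonoidHom_ker, h3, Nat.gcd_mul_right_left]

lemma natCard_orthogonal (hE : Module.finrank F E = 2) (h2 : (2 : F) ≠ 0) :
    Nat.card (isometryGroup (normForm F E)) = 2 * Fintype.card F + 2 := by
  have h1 : (specialOrthogonal F E).index = 2 := by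
    rw [Subgroup.index_eq_two_iff]
    refine ⟨conjugation hE, fun t => ?_⟩
    have : (specialOrthogonal F E).Normal := by
      unfold specialOrthogonal; infer_instance
    rw [this.mem_comm_iff]
    rcases mem_or_conjugation_mul_mem hE h2 t with h | h
    · refine Or.inr ⟨h, fun h3 => conjugation_notMem hE h2 ?_⟩
      exact (Subgroup.mul_mem_cancel_right _ h).mp h3
    · refine Or.inl ⟨h, fun h3 => conjugation_notMem hE h2 ?_⟩
      exact (Subgroup.mul_mem_cancel_right _ h3).mp h
  rw [← (specialOrthogonal F E).card_mul_index, h1, natCard_specialOrthogonal hE h2]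
  ring

/-- A character of order `2` of `SO(E)` and the trivial one are the only characters of exponent
`2`. -/
lemma character_eq_of_sq_eq_one {K : Type*} [Field K] (hE : Module.finrank F E = 2)
    (h2 : (2 : F) ≠ 0) {ν θ : specialOrthogonal F E →* Kˣ} (hν : orderOf ν = 2)
    (hθ : θ⁻¹ = θ) : θ = 1 ∨ θ = ν := by
  have := isCyclic_specialOrthogonal (F := F) (E := E) hE h2
  obtain ⟨g, hg⟩ := IsCyclic.exists_generator (α := specialOrthogonal F E)
  -- A character is determined by its value at a generator; for a self-inverse one this is ±1, and ν
  -- takes the value -1 because it is not trivial.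
  have hext : ∀ θ θ' : specialOrthogonal F E →* Kˣ, θ g = θ' g → θ = θ' := by
    intro θ θ' h
    ext x
    obtain ⟨n, rfl⟩ := Subgroup.mem_zpowers_iff.mp (hg x)
    rw [map_zpow, map_zpow, h]
  have hsq : ∀ x : Kˣ, x * x = 1 → x = 1 ∨ x = -1 := by
    intro x hx
    have h1 : (x : K) * x = 1 := by rw [← Units.val_mul, hx, Units.val_one]
    exact (mul_self_eq_one_iff.mp h1).imp (fun h => Units.ext h) fun h => Units.ext h
  have hνν : ν g * ν g = 1 := by
    rw [← MonoidHom.mul_apply, ← sq, ← hν, pow_orderOf_eq_one, MonoidHom.one_apply]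
  have hθθ : θ g * θ g = 1 := by
    nth_rewrite 1 [← hθ]
    simp
  rcases hsq _ hθθ with h | h
  · exact Or.inl (hext _ _ h)
  · rcases hsq _ hνν with h' | h'
    · have h1 : ν = 1 := hext _ _ h'
      rw [h1, orderOf_one] at hν
      omega
    · exact Or.inr (hext _ _ (h.trans h'.symm))

end OrthogonalGroup

/-! ### Witt's theorem and the orbits of Sp(V) on pairs of vectors -/

section SymplecticOrbits

variable {F V : Type*} [Field F] [AddCommGroup V] [Module F V] [FiniteDimensional F V]
  {B : LinearMap.BilinForm F V}

lemma exists_pairing_eq (hB : B.Nondegenerate) (hA : B.IsAlt) {ι : Type*} {x : ι → V}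
    (hx : LinearIndependent F x) (c : ι → F) : ∃ z, ∀ i, B (x i) z = c i := by
  obtain ⟨φ, hφ⟩ := LinearMap.exists_extend ((Module.Basis.span hx).constr F c)
  have hφx : ∀ i, φ (x i) = c i := fun i => by
    have h1 := LinearMap.congr_fun hφ (Module.Basis.span hx i)
    rwa [Module.Basis.constr_basis, LinearMap.comp_apply, Submodule.subtype_apply,
      Module.Basis.span_apply] at h1
  refine ⟨-(B.toDual hB).symm φ, fun i => ?_⟩
  -- The functional is represented in the first argument of B; the minus sign in the witness moves
  -- it to the second.
  rw [map_neg, hA.neg_eq, ← LinearMap.BilinForm.toDual_def hB, LinearEquiv.apply_symm_apply, hφx]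

/-- A Gram matrix of a symplectic basis whose first two vectors have product `c`. -/
def symplecticGram (c : F) : Matrix (Fin 4) (Fin 4) F :=
  !![0, c, 1, 0; -c, 0, 0, 1; -1, 0, 0, 0; 0, -1, 0, 0]

/-- Two independent vectors extend to a basis whose Gram matrix depends on their product only. -/
lemma exists_symplectic_basis (hB : B.Nondegenerate) (hA : B.IsAlt) (hV : Module.finrank F V = 4)
    {x y : V} (hxy : LinearIndependent F ![x, y]) :
    ∃ b : Module.Basis (Fin 4) F V, b 0 = x ∧ b 1 = y ∧
      ∀ i j, B (b i) (b j) = symplecticGram (B x y) i j := by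
  have hrange : Set.range ![x, y] = {x, y} := by simp [Set.pair_comm]
  obtain ⟨p, hp⟩ : ∃ p, p ∉ Submodule.span F (Set.range ![x, y]) := by
    by_contra! hcon
    have h1 := finrank_span_eq_card hxy
    have h3 : Submodule.span F (Set.range ![x, y]) = ⊤ := eq_top_iff.mpr fun v _ => hcon v
    rw [h3, finrank_top, hV] at h1
    simp at h1
  have hpxy : LinearIndependent F ![p, x, y] := linearIndependent_finCons.mpr ⟨hxy, hp⟩
  -- The value at p keeps z out of the span of x and y. An element of that span with the prescribed
  -- products with x and y has to be (B x y)⁻¹ y, whose product with p is (B x y)⁻¹ B(p, y); the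
  -- summand 1 excludes it. If B(x, y) = 0, then B(x, z) = 1 already excludes the span.
  obtain ⟨z, hz⟩ := exists_pairing_eq hB hA hpxy ![(B x y)⁻¹ * B p y + 1, 1, 0]
  have hpz : B p z = (B x y)⁻¹ * B p y + 1 := hz 0
  have hxz : B x z = 1 := hz 1
  have hyz : B y z = 0 := hz 2
  have hsw : ∀ u v, B v u = -B u v := fun u v => (hA.neg_eq u v).symm
  have hzspan : z ∉ Submodule.span F (Set.range ![x, y]) := by
    rw [hrange, Submodule.mem_span_pair]
    rintro ⟨α, β, rfl⟩
    simp only [map_add, map_smul, smul_eq_mul, hA.self_eq_zero, hsw x y] at hpz hxz hyz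
    have hc : B x y ≠ 0 := by
      intro h0
      rw [h0] at hxz
      simp at hxz
    have hα : α = 0 := by
      have : α * B x y = 0 := by linear_combination -hyz
      exact (mul_eq_zero.mp this).resolve_right hc
    have hβ : β = (B x y)⁻¹ := by
      refine eq_inv_of_mul_eq_one_left ?_
      linear_combination hxz
    rw [hα, hβ] at hpz
    simp at hpz
  have hzxy : LinearIndependent F ![z, x, y] := linearIndependent_finCons.mpr ⟨hxy, hzspan⟩
  -- Independence of z, x, y permits prescribing B(z, w) = 0 as well, which makes the Gram matrix
  -- depend on B(x, y) alone.
  obtain ⟨w, hw⟩ := exists_pairing_eq hB hA hzxy ![0, 0, 1]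
  have hzw : B z w = 0 := hw 0
  have hxw : B x w = 0 := hw 1
  have hyw : B y w = 1 := hw 2
  -- Pairing a relation with z and w kills the coefficients of x and y; pairing with x and y then
  -- kills the other two.
  have hli : LinearIndependent F ![x, y, z, w] := by
    rw [Fintype.linearIndependent_iff]
    intro g hg
    simp only [Fin.sum_univ_four, Matrix.cons_val] at hg
    have e : ∀ v, B v (g 0 • x + g 1 • y + g 2 • z + g 3 • w) = 0 := fun v => by
      rw [hg, map_zero]
    have e0 := e z
    have e1 := e w
    have e2 := e x
    have e3 := e y
    simp only [map_add, map_smul, smul_eq_mul, hA.self_eq_zero, hsw x z, hsw y z, hsw x w, hsw y w,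
      hsw z w, hsw x y, hxz, hyz, hzw, hxw, hyw] at e0 e1 e2 e3
    have g0 : g 0 = 0 := by linear_combination -e0
    have g1 : g 1 = 0 := by linear_combination -e1
    rw [g0, g1] at e2 e3
    have g2 : g 2 = 0 := by linear_combination e2
    have g3 : g 3 = 0 := by linear_combination e3
    intro i
    fin_cases i <;> assumption
  let b := basisOfLinearIndependentOfCardEqFinrank hli (by simp [hV])
  have hb : ⇑b = ![x, y, z, w] := coe_basisOfLinearIndependentOfCardEqFinrank _ _
  refine ⟨b, by rw [hb]; rfl, by rw [hb]; rfl, fun i j => ?_⟩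
  rw [hb]
  fin_cases i <;> fin_cases j <;>
    simp [symplecticGram, hA.self_eq_zero, hsw x y, hsw x z, hsw x w, hsw y z, hsw y w, hsw z w,
      hxz, hyz, hzw, hxw, hyw]

/-- **Witt's theorem** for pairs of independent vectors. -/
lemma exists_isometry_pair (hB : B.Nondegenerate) (hA : B.IsAlt) (hV : Module.finrank F V = 4)
    {x y x' y' : V} (hxy : LinearIndependent F ![x, y]) (hxy' : LinearIndependent F ![x', y'])
    (h : B x y = B x' y') : ∃ g : isometryGroup B, g.1 x = x' ∧ g.1 y = y' := by
  obtain ⟨b, hbx, hby, hb⟩ := exists_symplectic_basis hB hA hV hxy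
  obtain ⟨b', hbx', hby', hb'⟩ := exists_symplectic_basis hB hA hV hxy'
  have hg : ∀ i, b.equiv b' (Equiv.refl _) (b i) = b' i := fun i => by simp
  have hiso : B.compl₁₂ (b.equiv b' (Equiv.refl _)).toLinearMap
      (b.equiv b' (Equiv.refl _)).toLinearMap = B := by
    refine b.ext fun i => b.ext fun j => ?_
    simp only [LinearMap.compl₁₂_apply, LinearEquiv.coe_coe, hg]
    rw [hb, hb', h]
  refine ⟨⟨b.equiv b' (Equiv.refl _), fun v w => LinearMap.congr_fun₂ hiso v w⟩, ?_, ?_⟩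
  · rw [← hbx, ← hbx', hg]
  · rw [← hby, ← hby', hg]

lemma exists_hyperbolic_partner (hB : B.Nondegenerate) (hA : B.IsAlt) {x : V} (hx : x ≠ 0) :
    ∃ y, B x y = 1 ∧ LinearIndependent F ![x, y] := by
  obtain ⟨y, hy⟩ := exists_pairing_eq hB hA
    (linearIndependent_unique_iff (R := F) (ι := Unit) (v := fun _ => x) |>.mpr hx) fun _ => 1
  refine ⟨y, hy (), LinearIndependent.pair_iff.mpr fun s t hst => ?_⟩
  have h1 := congrArg (B x) hst
  have h3 := congrArg (fun v => B v y) hst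
  simp only [map_add, map_smul, LinearMap.add_apply, LinearMap.smul_apply, smul_eq_mul, map_zero,
    LinearMap.zero_apply, hA.self_eq_zero, hy ()] at h1 h3
  exact ⟨by linear_combination h3, by linear_combination h1⟩

lemma exists_isometry_vector (hB : B.Nondegenerate) (hA : B.IsAlt) (hV : Module.finrank F V = 4)
    {x x' : V} (hx : x ≠ 0) (hx' : x' ≠ 0) : ∃ g : isometryGroup B, g.1 x = x' := by
  obtain ⟨y, hy, hxy⟩ := exists_hyperbolic_partner hB hA hx
  obtain ⟨y', hy', hxy'⟩ := exists_hyperbolic_partner hB hA hx'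
  obtain ⟨g, hg, -⟩ := exists_isometry_pair hB hA hV hxy hxy' (hy.trans hy'.symm)
  exact ⟨g, hg⟩

open Classical in
/-- A complete invariant of the pairs of vectors under the symplectic group. -/
noncomputable def pairInvariant (B : LinearMap.BilinForm F V) (x y : V) : Bool ⊕ (F ⊕ F) :=
  if x = 0 then Sum.inl (decide (y = 0))
  else if h : ∃ c : F, c • x = y then Sum.inr (Sum.inl h.choose)
  else Sum.inr (Sum.inr (B x y))

lemma pairInvariant_zero (y : V) [Decidable (y = 0)] :
    pairInvariant B 0 y = Sum.inl (decide (y = 0)) := by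
  rw [pairInvariant, if_pos rfl]
  congr!

lemma pairInvariant_smul {x : V} (hx : x ≠ 0) (c : F) :
    pairInvariant B x (c • x) = Sum.inr (Sum.inl c) := by
  have h : ∃ a : F, a • x = c • x := ⟨c, rfl⟩
  rw [pairInvariant, if_neg hx, dif_pos h, smul_left_injective F hx h.choose_spec]

lemma pairInvariant_of_linearIndependent {x y : V} (h : LinearIndependent F ![x, y]) :
    pairInvariant B x y = Sum.inr (Sum.inr (B x y)) := by
  have hx : x ≠ 0 := h.ne_zero 0
  rw [pairInvariant, if_neg hx, dif_neg]
  exact not_exists.mpr ((LinearIndependent.pair_iff' hx).mp h)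

lemma pair_cases (x y : V) : x = 0 ∨ x ≠ 0 ∧ (∃ c : F, c • x = y) ∨
    LinearIndependent F ![x, y] := by
  by_cases hx : x = 0
  · exact Or.inl hx
  · by_cases h : ∃ c : F, c • x = y
    · exact Or.inr (Or.inl ⟨hx, h⟩)
    · exact Or.inr (Or.inr ((LinearIndependent.pair_iff' hx).mpr (not_exists.mp h)))

lemma pairInvariant_isometry (g : isometryGroup B) (x y : V) :
    pairInvariant B (g.1 x) (g.1 y) = pairInvariant B x y := by
  classical
  rcases pair_cases (F := F) x y with rfl | ⟨hx, c, rfl⟩ | h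
  · rw [map_zero, pairInvariant_zero, pairInvariant_zero]
    simp
  · rw [map_smul, pairInvariant_smul (by simpa using hx), pairInvariant_smul hx]
  · have h1 : LinearIndependent F ![g.1 x, g.1 y] := by
      have h3 : ![g.1 x, g.1 y] = g.1.toLinearMap ∘ ![x, y] := by
        ext i; fin_cases i <;> rfl
      rw [h3]
      exact h.map' g.1.toLinearMap g.1.ker
    rw [pairInvariant_of_linearIndependent h1, pairInvariant_of_linearIndependent h, g.2]

lemma exists_isometry_of_pairInvariant (hB : B.Nondegenerate) (hA : B.IsAlt)
    (hV : Module.finrank F V = 4) {x y x' y' : V}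
    (h : pairInvariant B x y = pairInvariant B x' y') :
    ∃ g : isometryGroup B, g.1 x = x' ∧ g.1 y = y' := by
  classical
  rcases pair_cases (F := F) x y with rfl | ⟨hx, c, rfl⟩ | hxy <;>
  rcases pair_cases (F := F) x' y' with rfl | ⟨hx', c', rfl⟩ | hxy'
  · rw [pairInvariant_zero, pairInvariant_zero, Sum.inl.injEq, decide_eq_decide] at h
    by_cases hy : y = 0
    · exact ⟨1, map_zero _, by rw [hy, h.mp hy, map_zero]⟩
    · obtain ⟨g, hg⟩ := exists_isometry_vector hB hA hV hy fun h0 => hy (h.mpr h0)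
      exact ⟨g, map_zero _, hg⟩
  · simp [pairInvariant_zero, pairInvariant_smul hx'] at h
  · simp [pairInvariant_zero, pairInvariant_of_linearIndependent hxy'] at h
  · simp [pairInvariant_zero, pairInvariant_smul hx] at h
  · rw [pairInvariant_smul hx, pairInvariant_smul hx'] at h
    obtain ⟨g, hg⟩ := exists_isometry_vector hB hA hV hx hx'
    refine ⟨g, hg, ?_⟩
    rw [map_smul, hg, Sum.inl_injective (Sum.inr_injective h)]
  · simp [pairInvariant_smul hx, pairInvariant_of_linearIndependent hxy'] at h
  · simp [pairInvariant_zero, pairInvariant_of_linearIndependent hxy] at h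
  · simp [pairInvariant_smul hx', pairInvariant_of_linearIndependent hxy] at h
  · rw [pairInvariant_of_linearIndependent hxy, pairInvariant_of_linearIndependent hxy'] at h
    exact exists_isometry_pair hB hA hV hxy hxy' (Sum.inr_injective (Sum.inr_injective h))

lemma pairInvariant_surjective (hB : B.Nondegenerate) (hA : B.IsAlt)
    (hV : Module.finrank F V = 4) (i : Bool ⊕ (F ⊕ F)) : ∃ x y, pairInvariant B x y = i := by
  classical
  have hnt : Nontrivial V := Module.nontrivial_of_finrank_pos (R := F) (by omega)
  obtain ⟨v, hv⟩ := exists_ne (0 : V)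
  rcases i with b | c | c
  · cases b
    · exact ⟨0, v, by simp [pairInvariant_zero, hv]⟩
    · exact ⟨0, 0, by simp [pairInvariant_zero]⟩
  · exact ⟨v, c • v, pairInvariant_smul hv c⟩
  · obtain ⟨b, hbx, hby, hb⟩ := exists_symplectic_basis hB hA hV
      (exists_hyperbolic_partner hB hA hv).choose_spec.2
    -- In the symplectic basis b 3 is orthogonal to b 0 and has product -1 with b 1, so this pair
    -- has product c. The b 0 component keeps it independent even for c = 0.
    have hli : LinearIndependent F ![b 3, b 0 - c • b 1] := by
      rw [LinearIndependent.pair_iff]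
      intro s t hst
      have h1 := Fintype.linearIndependent_iff.mp b.linearIndependent ![t, -(t * c), 0, s] (by
        simp only [Fin.sum_univ_four, Matrix.cons_val]
        rw [← hst]
        module)
      exact ⟨h1 3, h1 0⟩
    refine ⟨b 3, b 0 - c • b 1, ?_⟩
    rw [pairInvariant_of_linearIndependent hli, map_sub, map_smul, hb, hb]
    simp [symplecticGram]

end SymplecticOrbits

/-! ### The orbits of Sp(V) on V ⊗ E -/

section TensorOrbits

variable {F E V : Type*} [Field F] [Fintype F] [Field E] [Algebra F E] [FiniteDimensional F E]
  [AddCommGroup V] [Module F V] [FiniteDimensional F V]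

/-- Coordinates on `V ⊗ E` with respect to a basis of `E`. -/
noncomputable def tensorPair (V : Type*) [AddCommGroup V] [Module F V]
    (b : Module.Basis (Fin 2) F E) : (V ⊗[F] E) ≃ₗ[F] (Fin 2 → V) :=
  (TensorProduct.equivFinsuppOfBasisRight b).trans (Finsupp.linearEquivFunOnFinite F V (Fin 2))

lemma tensorPair_tmul (b : Module.Basis (Fin 2) F E) (v : V) (e : E) (i : Fin 2) :
    tensorPair V b (v ⊗ₜ e) i = b.repr e i • v := by
  simp [tensorPair]

lemma tensorPair_rTensor {U : Type*} [AddCommGroup U] [Module F U] [FiniteDimensional F U]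
    (b : Module.Basis (Fin 2) F E)
    (g : V →ₗ[F] U) (x : V ⊗[F] E) (i : Fin 2) :
    tensorPair U b (g.rTensor E x) i = g (tensorPair V b x i) := by
  induction x with
  | zero => simp
  | add x y hx hy => simp [hx, hy]
  | tmul v e => rw [LinearMap.rTensor_tmul, tensorPair_tmul, tensorPair_tmul, map_smul]

/-- Coordinates in a basis of E make V ⊗ E the set of pairs of vectors with the diagonal action, and
`pairInvariant` identifies the orbits with `Bool ⊕ (F ⊕ F)`. -/
lemma natCard_spOrbits {B : LinearMap.BilinForm F V} (hB : B.Nondegenerate) (hA : B.IsAlt)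
    (hE : Module.finrank F E = 2) (hV : Module.finrank F V = 4) :
    Nat.card (SpOrbits E B) = 2 * Fintype.card F + 2 := by
  let b : Module.Basis (Fin 2) F E := Module.finBasisOfFinrankEq F E hE
  let inv : V ⊗[F] E → Bool ⊕ (F ⊕ F) :=
    fun x => pairInvariant B (tensorPair V b x 0) (tensorPair V b x 1)
  have hact : ∀ (g : isometryGroup B) (x : V ⊗[F] E) i,
      tensorPair V b ((tensorHom E B (g, 1)).1 x) i = g.1 (tensorPair V b x i) := fun g x i =>
    tensorPair_rTensor b g.1.toLinearMap x i
  let f : SpOrbits E B → Bool ⊕ (F ⊕ F) := fun o => Quotient.liftOn' o inv (by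
    rintro _ y ⟨⟨_, g, rfl⟩, rfl⟩
    change pairInvariant B (tensorPair V b ((tensorHom E B (g, 1)).1 y) 0)
      (tensorPair V b ((tensorHom E B (g, 1)).1 y) 1) = inv y
    rw [hact, hact, pairInvariant_isometry])
  have hf : Function.Bijective f := by
    refine ⟨fun o o' h => ?_, fun i => ?_⟩
    · induction o using Quotient.inductionOn' with
      | h x =>
        induction o' using Quotient.inductionOn' with
        | h y =>
          obtain ⟨g, h0, h1⟩ := exists_isometry_of_pairInvariant hB hA hV
            (show inv y = inv x from h.symm)
          refine Quotient.sound' (show x ∈ MulAction.orbit _ y from ⟨⟨_, g, rfl⟩, ?_⟩)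
          change (tensorHom E B (g, 1)).1 y = x
          apply (tensorPair V b).injective
          ext i
          rw [hact]
          fin_cases i
          · exact h0
          · exact h1
    · obtain ⟨x, y, h⟩ := pairInvariant_surjective hB hA hV i
      refine ⟨Quotient.mk'' ((tensorPair V b).symm ![x, y]), ?_⟩
      change inv _ = i
      simp only [inv, LinearEquiv.apply_symm_apply]
      exact h
  rw [Nat.card_congr (Equiv.ofBijective f hf), Nat.card_eq_fintype_card]
  simp
  ring

end TensorOrbits

/-! ### Operators induced by automorphisms of the Lagrangian A' -/

section GeometricOperators

variable {F K M : Type*} [Field F] [Field K] [AddCommGroup M] [Module F M]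
  {B : LinearMap.BilinForm F M} {A A' : Submodule F M}

/-- The action of the automorphisms of `A'` on the functions on `A'`. -/
def functionAction (K : Type*) [Field K] (A' : Submodule F M) :
    Representation K (A' ≃ₗ[F] A') (A' → K) where
  toFun g := LinearMap.funLeft K K g.symm
  map_one' := rfl
  map_mul' _ _ := rfl

lemma functionAction_apply (g : A' ≃ₗ[F] A') (f : A' → K) (v : A') :
    functionAction K A' g f v = f (g.symm v) := rfl

lemma functionAction_mem_parity (g : A' ≃ₗ[F] A') (ε : ℤˣ) :
    ∀ f ∈ paritySubmodule K A' ε, functionAction K A' g f ∈ paritySubmodule K A' ε :=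
  fun f hf v => by
    rw [functionAction_apply, functionAction_apply, map_neg]
    exact hf _

/-- The scalar by which `normalize` changes the geometric action of an automorphism of `A'`. -/
noncomputable def parityRatio (K : Type*) [Field K] [Finite M] (A' : Submodule F M) :
    (A' ≃ₗ[F] A') →* K where
  toFun g := parityDet (functionAction K A' g) (-1) / parityDet (functionAction K A' g) 1
  map_one' := by rw [map_one, parityDet_one, parityDet_one, div_one]
  map_mul' g h := by
    rw [map_mul, parityDet_mul (functionAction_mem_parity g _) (functionAction_mem_parity h _),
      parityDet_mul (functionAction_mem_parity g _) (functionAction_mem_parity h _),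
      mul_div_mul_comm]

lemma normalize_functionAction [Finite M] (g : A' ≃ₗ[F] A') :
    normalize (functionAction K A' g) = parityRatio K A' g • functionAction K A' g := rfl

/-- An isometry preserving both A and A' commutes with the two projections, and B is invariant, so
substitution turns the formula for ρ(x) into that for ρ(gx). -/
lemma intertwines_functionAction (hP : IsPolarization B A A') (ψ : AddChar F K)
    (g : isometryGroup B) (a : A' ≃ₗ[F] A') (hA : ∀ x ∈ A, g.1 x ∈ A)
    (hA' : ∀ v : A', g.1 v = a v) : Intertwines hP ψ g (functionAction K A' a) := by
  intro x
  have hleft : (A.projectionOnto A' hP.isCompl (g.1 x) : M)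
      = g.1 (A.projectionOnto A' hP.isCompl x) := by
    conv_lhs => rw [← decomp hP.isCompl x, map_add, hA', map_add]
    rw [Submodule.projectionOnto_apply_of_mem_right hP.isCompl (a _).2, add_zero]
    have h := Submodule.projectionOnto_apply_left hP.isCompl
      ⟨g.1 (A.projectionOnto A' hP.isCompl x), hA _ (Subtype.prop _)⟩
    exact congrArg Subtype.val h
  have hright : A'.projectionOnto A hP.isCompl.symm (g.1 x)
      = a (A'.projectionOnto A hP.isCompl.symm x) := by
    conv_lhs => rw [← decomp hP.isCompl x, map_add, hA', map_add]
    rw [Submodule.projectionOnto_apply_of_mem_right hP.isCompl.symm (hA _ (Subtype.prop _)),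
      zero_add, Submodule.projectionOnto_apply_left]
  refine LinearMap.ext fun f => funext fun v => ?_
  simp only [Module.End.mul_apply, functionAction_apply, heis_apply]
  obtain ⟨w, rfl⟩ := a.surjective v
  rw [hleft, hright, ← map_sub a, a.symm_apply_apply, a.symm_apply_apply, ← hA', ← hA', g.2, g.2]

lemma functionAction_ne_zero (a : A' ≃ₗ[F] A') : functionAction K A' a ≠ 0 := by
  intro h
  have h1 := congrFun (LinearMap.congr_fun h fun _ => 1) 0
  simp [functionAction_apply] at h1

variable [Finite M] [CharZero K]

/-- Intertwiners are unique up to scalars and `normalize` ignores scalars, so the chosen intertwiner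
may be replaced by an explicit one. -/
lemma weilRepresentation_eq_normalize (hP : IsPolarization B A A') (h2 : (2 : F) ≠ 0)
    (ψ : AddChar F K) (hψ : ψ ≠ 1) (g : isometryGroup B) {T : Module.End K (A' → K)}
    (hT : Intertwines hP ψ g T) (hT0 : T ≠ 0) :
    weilRepresentation hP h2 ψ hψ g = normalize T := by
  obtain ⟨h1, h0⟩ := (exists_intertwines hP ψ hψ h2 g).choose_spec
  obtain ⟨c, hc⟩ := h1.unique hψ hT hT0
  have hc0 : c ≠ 0 := by
    rintro rfl
    exact h0 (by rw [hc, zero_smul])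
  change normalize _ = _
  rw [hc, normalize_smul h2 hc0 (hT.mapsTo hψ h2 hT0)]

end GeometricOperators

/-! ### The geometric action of O(E) on W -/

section TensorAction

variable {F E V K : Type*} [Field F] [Fintype F] [Field E] [Algebra F E] [FiniteDimensional F E]
  [AddCommGroup V] [Module F V] [FiniteDimensional F V] [Field K] [CharZero K]

/-- The linear automorphism `1 ⊗ t` of `L' ⊗ E`. -/
noncomputable def tensorActEquiv (L' : Submodule F V) :
    (E ≃ₗ[F] E) →* (tensorSubmodule E L' ≃ₗ[F] tensorSubmodule E L') where
  toFun t :=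
    { toFun := tensorAct L' t
      map_add' := fun v w => Subtype.ext (map_add _ _ _)
      map_smul' := fun c v => Subtype.ext (map_smul _ _ _)
      invFun := tensorAct L' t.symm
      left_inv := fun v => Subtype.ext
        ((TensorProduct.congr (LinearEquiv.refl F V) t).symm_apply_apply v)
      right_inv := fun v => Subtype.ext
        ((TensorProduct.congr (LinearEquiv.refl F V) t).apply_symm_apply v) }
  map_one' := LinearEquiv.ext fun v => Subtype.ext (by
    change TensorProduct.congr (LinearEquiv.refl F V) (LinearEquiv.refl F E) v = v
    simp)
  map_mul' s t := LinearEquiv.ext fun v => Subtype.ext (by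
    change TensorProduct.congr (LinearEquiv.refl F V) (t.trans s) v
      = TensorProduct.congr (LinearEquiv.refl F V) s (TensorProduct.congr (LinearEquiv.refl F V) t v)
    induction (v : V ⊗[F] E) with
    | zero => simp
    | add x y hx hy => simp only [map_add, hx, hy]
    | tmul x e => simp)

lemma tensorActEquiv_apply (L' : Submodule F V) (t : E ≃ₗ[F] E) (v : tensorSubmodule E L') :
    tensorActEquiv L' t v = tensorAct L' t v := rfl

/-- If `L'` has dimension two, `L' ⊗ E` is the sum of two copies of `E`. -/
lemma exists_tensorSubmodule_equiv {L' : Submodule F V} (hL' : Module.finrank F L' = 2) :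
    ∃ e : tensorSubmodule E L' ≃ₗ[F] (Fin 2 → E),
      ∀ (t : E ≃ₗ[F] E) v i, e (tensorAct L' t v) i = t (e v i) := by
  let b : Module.Basis (Fin 2) F L' := Module.finBasisOfFinrankEq F L' hL'
  have hinj : Function.Injective (L'.subtype.rTensor E) :=
    Module.Flat.rTensor_preserves_injective_linearMap _ L'.injective_subtype
  let e1 : (L' ⊗[F] E) ≃ₗ[F] tensorSubmodule E L' := LinearEquiv.ofInjective _ hinj
  let e2 : (L' ⊗[F] E) ≃ₗ[F] (Fin 2 → E) :=
    (TensorProduct.equivFinsuppOfBasisLeft b).trans (Finsupp.linearEquivFunOnFinite F E (Fin 2))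
  have he2 : ∀ l e i, e2 (l ⊗ₜ e) i = b.repr l i • e := fun l e i => by simp [e2]
  refine ⟨e1.symm.trans e2, fun t v i => ?_⟩
  obtain ⟨x, rfl⟩ := e1.surjective v
  have h1 : tensorAct L' t (e1 x) = e1 (t.toLinearMap.lTensor L' x) := by
    refine Subtype.ext ?_
    change TensorProduct.congr (LinearEquiv.refl F V) t (L'.subtype.rTensor E x)
      = L'.subtype.rTensor E (t.toLinearMap.lTensor L' x)
    induction x with
    | zero => simp
    | add x y hx hy => simp only [map_add, hx, hy]
    | tmul x e => simp
  have h3 : ∀ y, (e1.symm.trans e2) (e1 y) = e2 y := fun y => by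
    rw [LinearEquiv.trans_apply, e1.symm_apply_apply]
  rw [h1, h3, h3]
  clear h1
  induction x with
  | zero => simp
  | add x y hx hy => simp only [map_add, Pi.add_apply, hx, hy]
  | tmul x e => rw [LinearMap.lTensor_tmul, he2, he2, map_smul]; rfl

lemma finrank_eq_two {B : LinearMap.BilinForm F V} {L L' : Submodule F V}
    (hP : IsPolarization B L L') (hV : Module.finrank F V = 4) : Module.finrank F L' = 2 := by
  have h1 := Submodule.finrank_add_eq_of_isCompl hP.isCompl
  have h3 := hP.finrank_eq
  omega

/-- The scalar left by the normalization is trivial on O(E). On L' ⊗ E ≅ E ⊕ E the isometry s acts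
as diag(s, s), the product of diag(s, 1) and its conjugate by the swap of the summands. A
multiplicative function with commuting values therefore takes the same value there as at diag(s²,
1), which is 1 for an involution s; and O(E) is generated by involutions. -/
lemma parityRatio_tensorActEquiv [Finite (V ⊗[F] E)] {L' : Submodule F V}
    (hE : Module.finrank F E = 2)
    (h2 : (2 : F) ≠ 0) (hL' : Module.finrank F L' = 2) (t : isometryGroup (normForm F E)) :
    parityRatio K (tensorSubmodule E L') (tensorActEquiv L' t.1) = 1 := by
  obtain ⟨e, he⟩ := exists_tensorSubmodule_equiv (E := E) hL'
  let conj : ((Fin 2 → E) ≃ₗ[F] (Fin 2 → E)) →*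
      (tensorSubmodule E L' ≃ₗ[F] tensorSubmodule E L') :=
    { toFun := fun h => (e.trans h).trans e.symm
      map_one' := LinearEquiv.ext fun v => e.symm_apply_apply v
      map_mul' := fun h h' => LinearEquiv.ext fun v => by simp }
  let χ := (parityRatio K (tensorSubmodule E L')).comp conj
  let w : (Fin 2 → E) ≃ₗ[F] (Fin 2 → E) := LinearEquiv.funCongrLeft F E (Equiv.swap 0 1)
  let j : (E ≃ₗ[F] E) →* ((Fin 2 → E) ≃ₗ[F] (Fin 2 → E)) :=
    { toFun := fun s => LinearEquiv.piCongrRight ![s, 1]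
      map_one' := by
        ext v i
        fin_cases i <;> rfl
      map_mul' := fun s s' => by
        ext v i
        fin_cases i <;> rfl }
  have hww : w * w = 1 := by
    ext v i
    fin_cases i <;> rfl
  have hdecomp : ∀ s : E ≃ₗ[F] E, tensorActEquiv L' s = conj (j s * (w * j s * w)) := by
    intro s
    refine LinearEquiv.ext fun v => e.injective (funext fun i => ?_)
    rw [tensorActEquiv_apply, he]
    change _ = e (e.symm ((j s * (w * j s * w)) (e v))) i
    rw [e.apply_symm_apply]
    fin_cases i <;> rfl
  have hχ : ∀ s : E ≃ₗ[F] E, parityRatio K (tensorSubmodule E L') (tensorActEquiv L' s)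
      = χ (j (s * s)) := by
    intro s
    have h1 : χ w * χ w = 1 := by rw [← map_mul, hww, map_one]
    rw [hdecomp]
    change χ (j s * (w * j s * w)) = _
    simp only [map_mul]
    linear_combination (χ (j s) * χ (j s)) * h1
  obtain ⟨r, s, hr, hs, rfl⟩ := exists_involutions hE h2 t
  have hr' : r.1 * r.1 = 1 := congrArg Subtype.val hr
  have hs' : s.1 * s.1 = 1 := congrArg Subtype.val hs
  rw [show (r * s).1 = r.1 * s.1 from rfl, map_mul, map_mul, hχ, hχ, hr', hs', map_one, map_one,
    mul_one]

variable {B : LinearMap.BilinForm F V} {L L' : Submodule F V}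

/-- The orthogonal group acts geometrically in the Weil representation. -/
lemma weilO_eq_functionAction (hP : IsPolarization B L L') (hE : Module.finrank F E = 2)
    (hV : Module.finrank F V = 4) (h2 : (2 : F) ≠ 0) (ψ : AddChar F K) (hψ : ψ ≠ 1)
    (t : isometryGroup (normForm F E)) :
    weilO hP hE h2 ψ hψ t = functionAction K (tensorSubmodule E L') (tensorActEquiv L' t.1) := by
  have : Finite (V ⊗[F] E) := Module.finite_of_finite F
  have h1 : Intertwines (isPolarization_tensor hP hE h2) ψ (tensorHom E B (1, t))
      (functionAction K (tensorSubmodule E L') (tensorActEquiv L' t.1)) :=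
    intertwines_functionAction _ ψ (tensorHom E B (1, t)) _
      (fun x hx => (tensorAct L t.1 ⟨x, hx⟩).2) fun v => rfl
  have h3 := weilRepresentation_eq_normalize (isPolarization_tensor hP hE h2) h2 ψ hψ _ h1
    (functionAction_ne_zero _)
  rw [normalize_functionAction,
    parityRatio_tensorActEquiv hE h2 (finrank_eq_two hP hV), one_smul] at h3
  exact h3

lemma weilO_apply (hP : IsPolarization B L L') (hE : Module.finrank F E = 2)
    (hV : Module.finrank F V = 4) (h2 : (2 : F) ≠ 0) (ψ : AddChar F K) (hψ : ψ ≠ 1)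
    (t : isometryGroup (normForm F E)) (f : tensorSubmodule E L' → K)
    (v : tensorSubmodule E L') : weilO hP hE h2 ψ hψ t f v = f (tensorAct L' (t⁻¹).1 v) := by
  rw [weilO_eq_functionAction hP hE hV]
  rfl

/-- `O(E)` has a free orbit on `L' ⊗ E`. -/
lemma exists_free_point {L' : Submodule F V} (hL' : Module.finrank F L' = 2)
    (hE : Module.finrank F E = 2) (h2 : (2 : F) ≠ 0) : ∃ v : tensorSubmodule E L',
    ∀ t : isometryGroup (normForm F E), tensorAct L' t.1 v = v → t = 1 := by
  obtain ⟨e, he⟩ := exists_tensorSubmodule_equiv (E := E) hL'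
  obtain ⟨d, -, -, hsp, -⟩ := exists_anti_invariant hE h2
  -- The point (1, d) of E ⊕ E has trivial stabilizer because 1 and d span E.
  refine ⟨e.symm ![1, d], fun t ht => Subtype.ext (LinearEquiv.toLinearMap_injective
    (LinearMap.ext_on hsp ?_))⟩
  have h : ∀ i, t.1 (![1, d] i) = ![1, d] i := fun i => by
    have h1 := he t.1 (e.symm ![1, d]) i
    rw [ht, e.apply_symm_apply] at h1
    exact h1.symm
  rintro x (rfl | rfl)
  · exact h 0
  · exact h 1

end TensorAction

/-! ### The commutant of Sp(V) and the decomposition of W -/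

section Decomposition

variable {F E V K : Type*} [Field F] [Fintype F] [Field E] [Algebra F E] [FiniteDimensional F E]
  [AddCommGroup V] [Module F V] [FiniteDimensional F V] [Field K] [CharZero K]
  {B : LinearMap.BilinForm F V} {L L' : Submodule F V}

lemma finite_isometryGroup {M : Type*} [AddCommGroup M] [Module F M] [FiniteDimensional F M]
    (C : LinearMap.BilinForm F M) : Finite (isometryGroup C) := by
  have : Finite M := Module.finite_of_finite F
  have : Finite (M ≃ₗ[F] M) := Finite.of_injective _ DFunLike.coe_injective
  infer_instance

open Classical in
lemma weilO_single (hP : IsPolarization B L L') (hE : Module.finrank F E = 2)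
    (hV : Module.finrank F V = 4) (h2 : (2 : F) ≠ 0) (ψ : AddChar F K) (hψ : ψ ≠ 1)
    {v : tensorSubmodule E L'}
    (hv : ∀ t : isometryGroup (normForm F E), tensorAct L' t.1 v = v → t = 1)
    (t s : isometryGroup (normForm F E)) :
    weilO hP hE h2 ψ hψ t (Pi.single v 1) (tensorAct L' s.1 v) = if t = s then 1 else 0 := by
  rw [weilO_apply hP hE hV, Pi.single_apply]
  have h : tensorAct L' (t⁻¹).1 (tensorAct L' s.1 v) = tensorAct L' (t⁻¹ * s).1 v := by
    simp only [← tensorActEquiv_apply]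
    exact (LinearEquiv.congr_fun (map_mul (tensorActEquiv L') (t⁻¹).1 s.1) v).symm
  rw [h]
  congr 1
  refine propext ⟨fun h1 => (inv_mul_eq_one.mp (hv _ h1)), fun h1 => ?_⟩
  rw [h1, inv_mul_cancel]
  exact LinearEquiv.congr_fun (map_one (tensorActEquiv L')) v

/-- O(E) moves the delta function at a free point to deltas at distinct points, so evaluating a
relation along the orbit reads off each coefficient. -/
lemma linearIndependent_weilO (hP : IsPolarization B L L') (hE : Module.finrank F E = 2)
    (hV : Module.finrank F V = 4) (h2 : (2 : F) ≠ 0) (ψ : AddChar F K) (hψ : ψ ≠ 1) :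
    LinearIndependent K (weilO (E := E) hP hE h2 ψ hψ) := by
  classical
  have := finite_isometryGroup (normForm F E)
  cases nonempty_fintype (isometryGroup (normForm F E))
  obtain ⟨v, hv⟩ := exists_free_point (E := E) (finrank_eq_two hP hV) hE h2
  rw [Fintype.linearIndependent_iff]
  intro c hc s
  have h := congrFun (LinearMap.congr_fun hc (Pi.single v 1)) (tensorAct L' s.1 v)
  simpa [LinearMap.sum_apply, Finset.sum_apply, weilO_single hP hE hV h2 ψ hψ hv] using h

/-- The dimension of the algebra of endomorphisms of the representation of `Sp(V)`. -/
lemma finrank_intertwiningMap_weilSp (hP : IsPolarization B L L') (hE : Module.finrank F E = 2)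
    (h2 : (2 : F) ≠ 0) (ψ : AddChar F K) (hψ : ψ ≠ 1) :
    Module.finrank K (Representation.IntertwiningMap (weilSp (E := E) hP hE h2 ψ hψ)
      (weilSp (E := E) hP hE h2 ψ hψ)) = Nat.card (SpOrbits E B) :=
  haveI : Finite (V ⊗[F] E) := Module.finite_of_finite F
  finrank_intertwiningMap_weilRepresentation (isPolarization_tensor hP hE h2) h2 ψ hψ
    ((tensorHom E B).comp (MonoidHom.inl _ _))

/-- The commutant of `Sp(V)` is spanned by the operators of `O(E)`. -/
lemma exists_eq_sum_weilO [Fintype (isometryGroup (normForm F E))] (hP : IsPolarization B L L')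
    (hE : Module.finrank F E = 2) (hV : Module.finrank F V = 4) (h2 : (2 : F) ≠ 0)
    (ψ : AddChar F K) (hψ : ψ ≠ 1) (X : Module.End K (tensorSubmodule E L' → K))
    (hX : ∀ g, X * weilSp hP hE h2 ψ hψ g = weilSp hP hE h2 ψ hψ g * X) :
    ∃ c : isometryGroup (normForm F E) → K, X = ∑ t, c t • weilO hP hE h2 ψ hψ t := by
  let τ : isometryGroup (normForm F E) → Representation.IntertwiningMap
      (weilSp (E := E) hP hE h2 ψ hψ) (weilSp (E := E) hP hE h2 ψ hψ) := fun t =>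
    ⟨weilO hP hE h2 ψ hψ t, fun g => LinearMap.ext fun f => weilO_weilSp hP hE h2 ψ hψ t g f⟩
  have hsum : ∀ c : isometryGroup (normForm F E) → K,
      (∑ t, c t • τ t).toLinearMap = ∑ t, c t • weilO hP hE h2 ψ hψ t := fun c => by
    rw [Representation.IntertwiningMap.toLinearMap_sum]
    rfl
  have hli : LinearIndependent K τ := by
    rw [Fintype.linearIndependent_iff]
    intro c hc
    refine Fintype.linearIndependent_iff.mp (linearIndependent_weilO hP hE hV h2 ψ hψ) c ?_
    rw [← hsum, hc]
    rfl
  have hdim : Module.finrank K (Representation.IntertwiningMap (weilSp (E := E) hP hE h2 ψ hψ)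
      (weilSp (E := E) hP hE h2 ψ hψ)) = 2 * Fintype.card F + 2 :=
    (finrank_intertwiningMap_weilSp hP hE h2 ψ hψ).trans
      (natCard_spOrbits hP.nondegenerate hP.isAlt hE hV)
  -- `finrank` is 0 for spaces of infinite dimension, so a positive value proves finiteness.
  have : Module.Finite K (Representation.IntertwiningMap (weilSp (E := E) hP hE h2 ψ hψ)
      (weilSp (E := E) hP hE h2 ψ hψ)) := Module.finite_of_finrank_pos (by omega)
  -- The order of O(E) equals the number of orbits, hence the dimension of the commutant.
  have hspan := hli.span_eq_top_of_card_eq_finrank' (by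
    rw [hdim, ← natCard_orthogonal (F := F) (E := E) hE h2, Nat.card_eq_fintype_card])
  obtain ⟨c, hc⟩ := (Submodule.mem_span_range_iff_exists_fun K).mp
    (show (⟨X, hX⟩ : Representation.IntertwiningMap _ _) ∈ Submodule.span K (Set.range τ) by
      rw [hspan]; trivial)
  refine ⟨c, ?_⟩
  rw [← hsum, hc]

variable (hP : IsPolarization B L L') (hE : Module.finrank F E = 2) (h2 : (2 : F) ≠ 0)
  (ψ : AddChar F K) (hψ : ψ ≠ 1)

/-- The inverse enters through an equation so that the lemma also serves for η = θ when θ is its own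
inverse. -/
lemma conjugation_mem_isotypic {θ η : specialOrthogonal F E →* Kˣ} (hη : η = θ⁻¹)
    {f : tensorSubmodule E L' → K} (hf : f ∈ (isotypic hP hE h2 ψ hψ θ).toSubmodule) :
    weilO hP hE h2 ψ hψ (conjugation hE) f ∈ (isotypic hP hE h2 ψ hψ η).toSubmodule := by
  intro t
  rw [← Module.End.mul_apply, ← map_mul, mul_conjugation hE h2, map_mul, Module.End.mul_apply,
    hf t⁻¹, map_smul, hη, MonoidHom.inv_apply, map_inv]

lemma weilO_conjugation_conjugation (f : tensorSubmodule E L' → K) :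
    weilO hP hE h2 ψ hψ (conjugation hE) (weilO hP hE h2 ψ hψ (conjugation hE) f) = f := by
  rw [← Module.End.mul_apply, ← map_mul, conjugation_mul_self, map_one, Module.End.one_apply]

/-- Independence of isotypic parts, valid also when θ = θ⁻¹. A t with θ'(t) ≠ θ(t) eliminates a and
puts a + b in W_{θ⁻¹}; an s with θ'(s) ≠ θ⁻¹(s) then makes it vanish. -/
lemma add_eq_zero_of_mem_isotypic {θ θ' : specialOrthogonal F E →* Kˣ} (h : θ' ≠ θ)
    (h' : θ' ≠ θ⁻¹) {a b : tensorSubmodule E L' → K}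
    (ha : a ∈ (isotypic hP hE h2 ψ hψ θ).toSubmodule)
    (hb : b ∈ (isotypic hP hE h2 ψ hψ θ⁻¹).toSubmodule)
    (hab : a + b ∈ (isotypic hP hE h2 ψ hψ θ').toSubmodule) : a + b = 0 := by
  have hne : ∀ {χ χ' : specialOrthogonal F E →* Kˣ}, χ ≠ χ' →
      ∃ t, (χ t : K) - (χ' t : K) ≠ 0 := by
    intro χ χ' hχ
    obtain ⟨t, ht⟩ := DFunLike.ne_iff.mp hχ
    exact ⟨t, fun h0 => ht (Units.ext (sub_eq_zero.mp h0))⟩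
  obtain ⟨t, ht⟩ := hne h
  obtain ⟨s, hs⟩ := hne h'
  have e1 : ((θ' t : K) - (θ t : K)) • (a + b) ∈ (isotypic hP hE h2 ψ hψ θ⁻¹).toSubmodule := by
    have h1 := hab t
    rw [map_add, ha t, hb t] at h1
    have h3 : ((θ' t : K) - (θ t : K)) • (a + b) = ((θ⁻¹ t : Kˣ) - (θ t : K)) • b := by
      rw [sub_smul, ← h1]
      module
    rw [h3]
    exact Submodule.smul_mem _ _ hb
  have e2 := (Submodule.smul_mem_iff _ ht).mp e1
  have e3 : ((θ' s : K) - ((θ⁻¹ s : Kˣ) : K)) • (a + b) = 0 := by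
    rw [sub_smul, ← hab s, ← e2 s, sub_self]
  exact (smul_eq_zero.mp e3).resolve_left hs

lemma eq_zero_of_mem_isotypic {θ θ' : specialOrthogonal F E →* Kˣ} (h : θ ≠ θ')
    {f : tensorSubmodule E L' → K} (hf : f ∈ (isotypic hP hE h2 ψ hψ θ).toSubmodule)
    (hf' : f ∈ (isotypic hP hE h2 ψ hψ θ').toSubmodule) : f = 0 := by
  obtain ⟨t, ht⟩ := DFunLike.ne_iff.mp h
  have h1 : ((θ t : K) - (θ' t : K)) • f = 0 := by rw [sub_smul, ← hf t, ← hf' t, sub_self]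
  exact (smul_eq_zero.mp h1).resolve_left fun h0 => ht (Units.ext (sub_eq_zero.mp h0))

/-- Each isotypic part contains a function that takes different values at two conjugate points. -/
lemma exists_mem_isotypic (hV : Module.finrank F V = 4) (θ : specialOrthogonal F E →* Kˣ) :
    ∃ f ∈ (isotypic hP hE h2 ψ hψ θ).toSubmodule, ∃ v, f v = 1 ∧
      weilO hP hE h2 ψ hψ (conjugation hE) f v = 0 := by
  classical
  have := finite_isometryGroup (normForm F E)
  cases nonempty_fintype (specialOrthogonal F E)
  obtain ⟨v, hv⟩ := exists_free_point (E := E) (finrank_eq_two hP hV) hE h2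
  -- The θ-isotypic sum of the delta function at a free point v. Only t = 1 contributes at v, and
  -- nothing does at σv, since σ is outside SO(E).
  let f : tensorSubmodule E L' → K :=
    ∑ t : specialOrthogonal F E, ((θ t)⁻¹ : K) • weilO hP hE h2 ψ hψ t (Pi.single v 1)
  have hval : ∀ s : isometryGroup (normForm F E), f (tensorAct L' s.1 v)
      = ∑ t : specialOrthogonal F E, ((θ t)⁻¹ : K) * if (t : isometryGroup _) = s then 1 else 0 := by
    intro s
    simp only [f, Finset.sum_apply, Pi.smul_apply, weilO_single hP hE hV h2 ψ hψ hv, smul_eq_mul]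
  refine ⟨f, fun s => ?_, v, ?_, ?_⟩
  · simp only [f, map_sum, map_smul, Finset.smul_sum]
    refine Fintype.sum_equiv (Equiv.mulLeft s) _ _ fun t => ?_
    rw [Equiv.coe_mulLeft, smul_smul, map_mul, Subgroup.coe_mul, map_mul, Module.End.mul_apply]
    congr 1
    rw [Units.val_mul, mul_inv, mul_inv_cancel_left₀ (Units.ne_zero _)]
  · have h1 := hval 1
    have h3 : tensorAct L' (1 : isometryGroup (normForm F E)).1 v = v :=
      LinearEquiv.congr_fun (map_one (tensorActEquiv L')) v
    rw [h3] at h1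
    rw [h1, Finset.sum_eq_single 1]
    · simp
    · intro t _ ht
      rw [if_neg (by simpa using ht), mul_zero]
    · simp
  · rw [weilO_apply hP hE hV, inv_eq_of_mul_eq_one_right (conjugation_mul_self hE), hval]
    refine Finset.sum_eq_zero fun t _ => ?_
    rw [if_neg, mul_zero]
    intro h
    exact conjugation_notMem hE h2 (h ▸ t.2)

/-- The operators commuting with `Sp(V)` act on an isotypic part as combinations of the identity
and the conjugation. -/
lemma exists_eq_add_conjugation (hV : Module.finrank F V = 4)
    (X : Module.End K (tensorSubmodule E L' → K))
    (hX : ∀ g, X * weilSp hP hE h2 ψ hψ g = weilSp hP hE h2 ψ hψ g * X)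
    (θ : specialOrthogonal F E →* Kˣ) : ∃ α β : K,
      ∀ f ∈ (isotypic hP hE h2 ψ hψ θ).toSubmodule,
        X f = α • f + β • weilO hP hE h2 ψ hψ (conjugation hE) f := by
  have := finite_isometryGroup (normForm F E)
  cases nonempty_fintype (isometryGroup (normForm F E))
  obtain ⟨c, rfl⟩ := exists_eq_sum_weilO hP hE hV h2 ψ hψ X hX
  have h : ∀ t : isometryGroup (normForm F E), ∃ α β : K,
      ∀ f ∈ (isotypic hP hE h2 ψ hψ θ).toSubmodule,
        weilO hP hE h2 ψ hψ t f = α • f + β • weilO hP hE h2 ψ hψ (conjugation hE) f := by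
    intro t
    -- A rotation acts by its θ-value, and t = σ(σt) with σt a rotation acts by θ(σt)Λ.
    rcases mem_or_conjugation_mul_mem hE h2 t with ht | ht
    · exact ⟨θ ⟨t, ht⟩, 0, fun f hf => by rw [zero_smul, add_zero]; exact hf ⟨t, ht⟩⟩
    · refine ⟨0, θ ⟨_, ht⟩, fun f hf => ?_⟩
      have h1 := congrArg (weilO hP hE h2 ψ hψ (conjugation hE)) (hf ⟨_, ht⟩)
      rw [map_mul, Module.End.mul_apply, weilO_conjugation_conjugation] at h1
      rw [zero_smul, zero_add, h1, map_smul]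
  choose α β h using h
  refine ⟨∑ t, c t * α t, ∑ t, c t * β t, fun f hf => ?_⟩
  rw [Finset.sum_smul, Finset.sum_smul, ← Finset.sum_add_distrib, LinearMap.sum_apply]
  refine Finset.sum_congr rfl fun t _ => ?_
  rw [LinearMap.smul_apply, h t f hf, smul_add, smul_smul, smul_smul]

/-- If X = α + βΛ preserves W_θ, then βΛf = Xf - αf lies both in W_θ and in W_{θ⁻¹}, so it is zero
and X is the scalar α. -/
lemma isIrreducible_isotypic (hV : Module.finrank F V = 4) {θ : specialOrthogonal F E →* Kˣ}
    (hθ : θ⁻¹ ≠ θ) : (isotypic hP hE h2 ψ hψ θ).toRepresentation.IsIrreducible := by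
  have := finite_isometryGroup B
  refine isIrreducible_of_scalar _ ?_ fun X hX hXm => ?_
  · obtain ⟨f, hf, v, hfv, -⟩ := exists_mem_isotypic hP hE h2 ψ hψ hV θ
    refine (Submodule.ne_bot_iff _).mpr ⟨f, hf, fun h0 => ?_⟩
    simp [h0] at hfv
  · obtain ⟨α, β, h⟩ := exists_eq_add_conjugation hP hE h2 ψ hψ hV X hX θ
    refine ⟨α, fun f hf => ?_⟩
    have h1 : β • weilO hP hE h2 ψ hψ (conjugation hE) f = 0 := by
      refine eq_zero_of_mem_isotypic hP hE h2 ψ hψ hθ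
        (Submodule.smul_mem _ _ (conjugation_mem_isotypic hP hE h2 ψ hψ rfl hf)) ?_
      rw [eq_sub_of_add_eq' (h f hf).symm]
      exact sub_mem (hXm f hf) (Submodule.smul_mem _ _ hf)
    rw [h f hf, h1, add_zero]

lemma isotypicSign_le (θ : specialOrthogonal F E →* Kˣ) (ε : ℤˣ) :
    (isotypicSign hP hE h2 ψ hψ θ ε).toSubmodule ≤ (isotypic hP hE h2 ψ hψ θ).toSubmodule :=
  fun _ hf => hf.1

lemma exists_mem_isotypicSign (hV : Module.finrank F V = 4) {θ : specialOrthogonal F E →* Kˣ}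
    (hθ : θ⁻¹ = θ) (ε : ℤˣ) : ∃ f ∈ (isotypicSign hP hE h2 ψ hψ θ ε).toSubmodule, f ≠ 0 := by
  obtain ⟨f, hf, v, hfv, hfv'⟩ := exists_mem_isotypic hP hE h2 ψ hψ hV θ
  -- Nonzero for both signs: f is 1 and Λf is 0 at v.
  refine ⟨f + (ε : ℤ) • weilO hP hE h2 ψ hψ (conjugation hE) f, ⟨?_, ?_⟩, fun h0 => ?_⟩
  · exact add_mem hf
      (zsmul_mem (conjugation_mem_isotypic hP hE h2 ψ hψ hθ.symm hf) _)
  · rw [map_add, map_zsmul, weilO_conjugation_conjugation, smul_add, smul_smul, ← Units.val_mul,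
      Int.units_mul_self, Units.val_one, one_smul, add_comm]
  · have h1 := congrFun h0 v
    simp [hfv, hfv'] at h1

/-- Here Λ is the scalar ε, so α + βΛ is a scalar without assuming that X preserves the subspace.
This is what also compares different eigenspaces. -/
lemma exists_eq_smul_of_mem_isotypicSign (hV : Module.finrank F V = 4)
    (X : Module.End K (tensorSubmodule E L' → K))
    (hX : ∀ g, X * weilSp hP hE h2 ψ hψ g = weilSp hP hE h2 ψ hψ g * X)
    (θ : specialOrthogonal F E →* Kˣ) (ε : ℤˣ) : ∃ α : K,
      ∀ f ∈ (isotypicSign hP hE h2 ψ hψ θ ε).toSubmodule, X f = α • f := by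
  obtain ⟨α, β, h⟩ := exists_eq_add_conjugation hP hE h2 ψ hψ hV X hX θ
  refine ⟨α + β * (ε : ℤ), fun f hf => ?_⟩
  rw [h f hf.1, hf.2, add_smul, mul_smul, Int.cast_smul_eq_zsmul]

lemma isIrreducible_isotypicSign (hV : Module.finrank F V = 4)
    {θ : specialOrthogonal F E →* Kˣ} (hθ : θ⁻¹ = θ) (ε : ℤˣ) :
    (isotypicSign hP hE h2 ψ hψ θ ε).toRepresentation.IsIrreducible := by
  have := finite_isometryGroup B
  refine isIrreducible_of_scalar _ ?_ fun X hX _ =>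
    exists_eq_smul_of_mem_isotypicSign hP hE h2 ψ hψ hV X hX θ ε
  exact (Submodule.ne_bot_iff _).mpr (exists_mem_isotypicSign hP hE h2 ψ hψ hV hθ ε)

/-- The conjugation is an isomorphism from `W_θ` to `W_{θ⁻¹}`. -/
lemma nonempty_equiv_isotypic_inv (θ : specialOrthogonal F E →* Kˣ) :
    Nonempty ((isotypic hP hE h2 ψ hψ θ).toRepresentation.Equiv
      (isotypic hP hE h2 ψ hψ θ⁻¹).toRepresentation) := by
  let e : (isotypic hP hE h2 ψ hψ θ).toSubmodule ≃ₗ[K] (isotypic hP hE h2 ψ hψ θ⁻¹).toSubmodule :=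
    LinearEquiv.ofLinearMap
      ((weilO hP hE h2 ψ hψ (conjugation hE)).restrict fun f hf =>
        conjugation_mem_isotypic hP hE h2 ψ hψ rfl hf)
      ((weilO hP hE h2 ψ hψ (conjugation hE)).restrict fun f hf =>
        conjugation_mem_isotypic hP hE h2 ψ hψ (inv_inv θ).symm hf)
      (LinearMap.ext fun f => Subtype.ext (weilO_conjugation_conjugation hP hE h2 ψ hψ f))
      (LinearMap.ext fun f => Subtype.ext (weilO_conjugation_conjugation hP hE h2 ψ hψ f))
  exact ⟨Representation.Equiv.mk e fun g => LinearMap.ext fun f =>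
    Subtype.ext (weilO_weilSp hP hE h2 ψ hψ (conjugation hE) g f)⟩

/-- The extended isomorphism sends W_θ injectively into W_θ + W_{θ⁻¹}, which meets W_{θ'} only in 0
for any other θ'. Allowing a subrepresentation S of W_{θ'} covers the eigenspaces of Λ too. -/
lemma eq_or_eq_inv_of_equiv (hV : Module.finrank F V = 4)
    {θ θ' : specialOrthogonal F E →* Kˣ} {S : Subrepresentation (weilSp (E := E) hP hE h2 ψ hψ)}
    (hS : S.toSubmodule ≤ (isotypic hP hE h2 ψ hψ θ').toSubmodule)
    (φ : (isotypic hP hE h2 ψ hψ θ).toRepresentation.Equiv S.toRepresentation) :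
    θ' = θ ∨ θ' = θ⁻¹ := by
  have := finite_isometryGroup B
  by_contra! hcon
  obtain ⟨X, hX, hXm⟩ := exists_equivariant_extension φ
  obtain ⟨α, β, h⟩ := exists_eq_add_conjugation hP hE h2 ψ hψ hV X hX θ
  obtain ⟨f, hf, v, hfv, -⟩ := exists_mem_isotypic hP hE h2 ψ hψ hV θ
  have h1 := hS (hXm f hf).1
  rw [h f hf] at h1
  have h3 := add_eq_zero_of_mem_isotypic hP hE h2 ψ hψ hcon.1 hcon.2 (Submodule.smul_mem _ _ hf)
    (Submodule.smul_mem _ _ (conjugation_mem_isotypic hP hE h2 ψ hψ rfl hf)) h1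
  rw [← h f hf] at h3
  rw [(hXm f hf).2 h3] at hfv
  simp at hfv

/-- The extended isomorphism is a nonzero scalar on the source, so a nonzero f of the source lies in
the target as well; this determines the character and the sign. -/
lemma eq_and_eq_of_equiv (hV : Module.finrank F V = 4)
    {η η' : specialOrthogonal F E →* Kˣ} (hη : η⁻¹ = η) {ε ε' : ℤˣ}
    (φ : (isotypicSign hP hE h2 ψ hψ η ε).toRepresentation.Equiv
      (isotypicSign hP hE h2 ψ hψ η' ε').toRepresentation) : η = η' ∧ ε = ε' := by
  have := finite_isometryGroup B
  obtain ⟨X, hX, hXm⟩ := exists_equivariant_extension φ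
  obtain ⟨α, h⟩ := exists_eq_smul_of_mem_isotypicSign hP hE h2 ψ hψ hV X hX η ε
  obtain ⟨f, hf, hf0⟩ := exists_mem_isotypicSign hP hE h2 ψ hψ hV hη ε
  have hα : α ≠ 0 := by
    rintro rfl
    exact hf0 ((hXm f hf).2 (by rw [h f hf, zero_smul]))
  have hf' : f ∈ (isotypicSign hP hE h2 ψ hψ η' ε').toSubmodule := by
    rw [← Submodule.smul_mem_iff _ hα, ← h f hf]
    exact (hXm f hf).1
  refine ⟨by_contra fun hne => hf0 (eq_zero_of_mem_isotypic hP hE h2 ψ hψ hne hf.1 hf'.1), ?_⟩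
  have h1 : ((ε : ℤ) - (ε' : ℤ)) • f = 0 := by rw [sub_smul, ← hf.2, ← hf'.2, sub_self]
  rw [← Int.cast_smul_eq_zsmul K, smul_eq_zero, Int.cast_eq_zero] at h1
  exact Units.ext (sub_eq_zero.mp (h1.resolve_right hf0))

end Decomposition

end Weil

/-! ### The classification of the constituents of W -/

theorem mainTheorem2 {F E V K : Type*} [Field F] [Fintype F]
    [Field E] [Algebra F E] [FiniteDimensional F E]
    [AddCommGroup V] [Module F V] [FiniteDimensional F V]
    [Field K] [IsAlgClosed K] [CharZero K]
    (h2 : (2 : F) ≠ 0) (hE : Module.finrank F E = 2) (hV : Module.finrank F V = 4)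
    (B : LinearMap.BilinForm F V) (L L' : Submodule F V) (hP : Weil.IsPolarization B L L')
    (ψ : AddChar F K) (hψ : ψ ≠ 1)
    (ν : Weil.specialOrthogonal F E →* Kˣ) (hν : orderOf ν = 2) :
    -- the action of `O(E)` is the geometric one
    (∀ (t : Weil.isometryGroup (Weil.normForm F E)) (f : Weil.tensorSubmodule E L' → K)
        (v : Weil.tensorSubmodule E L'),
      Weil.weilO hP hE h2 ψ hψ t f v = f (Weil.tensorAct L' (t⁻¹).1 v)) ∧
    -- `W_θ` is irreducible and isomorphic to `W_{θ⁻¹}` for `θ ≠ 1, ν`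
    (∀ θ : Weil.specialOrthogonal F E →* Kˣ, θ ≠ 1 → θ ≠ ν →
      (Weil.isotypic hP hE h2 ψ hψ θ).toRepresentation.IsIrreducible ∧
      Nonempty ((Weil.isotypic hP hE h2 ψ hψ θ).toRepresentation.Equiv
        (Weil.isotypic hP hE h2 ψ hψ θ⁻¹).toRepresentation)) ∧
    -- the eigenspaces of `W_1` and `W_ν` are irreducible
    (∀ θ : Weil.specialOrthogonal F E →* Kˣ, θ = 1 ∨ θ = ν → ∀ ε : ℤˣ,
      (Weil.isotypicSign hP hE h2 ψ hψ θ ε).toRepresentation.IsIrreducible) ∧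
    -- there are no isomorphisms other than `W_θ ≅ W_{θ⁻¹}`
    (∀ θ θ' : Weil.specialOrthogonal F E →* Kˣ, θ ≠ 1 → θ ≠ ν → θ' ≠ 1 → θ' ≠ ν →
      Nonempty ((Weil.isotypic hP hE h2 ψ hψ θ).toRepresentation.Equiv
        (Weil.isotypic hP hE h2 ψ hψ θ').toRepresentation) → θ' = θ ∨ θ' = θ⁻¹) ∧
    (∀ θ η : Weil.specialOrthogonal F E →* Kˣ, θ ≠ 1 → θ ≠ ν → η = 1 ∨ η = ν → ∀ ε : ℤˣ,
      IsEmpty ((Weil.isotypic hP hE h2 ψ hψ θ).toRepresentation.Equiv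
        (Weil.isotypicSign hP hE h2 ψ hψ η ε).toRepresentation)) ∧
    (∀ η η' : Weil.specialOrthogonal F E →* Kˣ, η = 1 ∨ η = ν → η' = 1 ∨ η' = ν →
      ∀ ε ε' : ℤˣ,
      Nonempty ((Weil.isotypicSign hP hE h2 ψ hψ η ε).toRepresentation.Equiv
        (Weil.isotypicSign hP hE h2 ψ hψ η' ε').toRepresentation) → η = η' ∧ ε = ε') ∧
    -- the dimension of the endomorphism algebra is the number of orbits, which is `2 q + 2`
    Module.finrank K (Representation.IntertwiningMap (Weil.weilSp (E := E) hP hE h2 ψ hψ)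
        (Weil.weilSp (E := E) hP hE h2 ψ hψ)) = Nat.card (Weil.SpOrbits E B) ∧
    Nat.card (Weil.SpOrbits E B) = 2 * Fintype.card F + 2 := by
  have hνinv : ν⁻¹ = ν := MonoidHom.ext fun t => by
    rw [MonoidHom.inv_apply, inv_eq_iff_mul_eq_one, ← MonoidHom.mul_apply, ← sq, ← hν,
      pow_orderOf_eq_one, MonoidHom.one_apply]
  have hinv : ∀ η : Weil.specialOrthogonal F E →* Kˣ, η = 1 ∨ η = ν → η⁻¹ = η := by
    rintro η (rfl | rfl)
    · exact MonoidHom.ext fun t => by simp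
    · exact hνinv
  have hne : ∀ θ : Weil.specialOrthogonal F E →* Kˣ, θ ≠ 1 → θ ≠ ν → θ⁻¹ ≠ θ := fun θ h1 h3 h =>
    (Weil.character_eq_of_sq_eq_one hE h2 hν h).elim h1 h3
  refine ⟨Weil.weilO_apply hP hE hV h2 ψ hψ, fun θ h1 h3 => ⟨?_, ?_⟩, fun θ hθ ε => ?_,
    fun θ θ' _ _ _ _ ⟨φ⟩ => ?_, fun θ η h1 h3 hη ε => ⟨fun φ => ?_⟩,
    fun η η' hη _ ε ε' ⟨φ⟩ => ?_, ?_, ?_⟩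
  · exact Weil.isIrreducible_isotypic hP hE h2 ψ hψ hV (hne θ h1 h3)
  · exact Weil.nonempty_equiv_isotypic_inv hP hE h2 ψ hψ θ
  · exact Weil.isIrreducible_isotypicSign hP hE h2 ψ hψ hV (hinv θ hθ) ε
  · exact Weil.eq_or_eq_inv_of_equiv hP hE h2 ψ hψ hV le_rfl φ
  -- Either alternative, η = θ or η = θ⁻¹, gives θ = η because η is its own inverse.
  · have h : θ = η := by
      rcases Weil.eq_or_eq_inv_of_equiv hP hE h2 ψ hψ hV
        (Weil.isotypicSign_le hP hE h2 ψ hψ η ε) φ with h | h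
      · exact h.symm
      · exact (inv_inv θ).symm.trans ((congrArg (·⁻¹) h).symm.trans (hinv η hη))
    rw [h] at h1 h3
    exact hη.elim h1 h3
  · exact Weil.eq_and_eq_of_equiv hP hE h2 ψ hψ hV (hinv η hη) φ
  · exact Weil.finrank_intertwiningMap_weilSp hP hE h2 ψ hψ
  · exact Weil.natCard_spOrbits hP.nondegenerate hP.isAlt hE hV
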